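/- Let $I=[0,1)$ and let $I^2$ carry two-dimensional Lebesgue measure $\mathrm{mes}$; write $\|\cdot\|_p$ for the norm of $L^p(I^2)$ (real- or complex-valued functions). For $x\in I$ let $x=\sum_{k\ge 0}x_k2^{-k-1}$ be its binary expansion, $x_k\in\{0,1\}$ (the terminating one if $x$ is a dyadic rational), and for $n\in\mathbb N=\{0,1,2,\dots\}$ let $n=\sum_{k\ge 0}n_k2^k$, $n_k\in\{0,1\}$. The Walsh–Paley functions are $\omega_n(x)=\prod_{k\ge 0}(-1)^{n_kx_k}$. For $f\in L^1(I^2)$ put $$\hat f(i,j)=\int_{I^2}f(x^1,x^2)\,\omega_i(x^1)\omega_j(x^2)\,dx^1dx^2,\qquad S_k^{\triangle}f(x^1,x^2)=\sum_{i=0}^{k-1}\sum_{j=0}^{k-i-1}\hat f(i,j)\,\omega_i(x^1)\omega_j(x^2),$$ $$\sigma_n^{\triangle}f=\frac1n\sum_{k=0}^{n-1}S_k^{\triangle}f\quad(n\ge 1),\qquad \sigma_*^{\triangle}f=\sup_{n\ge 1}|\sigma_n^{\triangle}f| .$$ Then the maximal operator $\sigma_*^{\triangle}$ is of weak type $(L^1,L^1)$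 and of type $(L^p,L^p)$ for all $1<p\le\infty$. That is, $\sigma_*^{\triangle}f$ is measurable for every $f\in L^1(I^2)$, and: (i) there is an absolute constant $C$ such that $\mathrm{mes}\{x\in I^2:\sigma_*^{\triangle}f(x)>\lambda\}\le C\|f\|_1/\lambda$ for all $f\in L^1(I^2)$ and all $\lambda>0$; (ii) for every $1<p\le\infty$ there is a constant $C_p$ depending only on $p$ such that $\|\sigma_*^{\triangle}f\|_p\le C_p\|f\|_p$ for all $f\in L^p(I^2)$. -/

import Mathlib

open MeasureTheory
open scoped ENNReal NNReal

noncomputable section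

namespace WalshTriangle

/-- The unit square `I² = [0,1) × [0,1)`. -/
def unitSquare : Set (ℝ × ℝ) := Set.Ico (0 : ℝ) 1 ×ˢ Set.Ico (0 : ℝ) 1

/-- Two-dimensional Lebesgue measure on the unit square. -/
def squareMeasure : Measure (ℝ × ℝ) := volume.restrict unitSquare

/-- The Rademacher function `r_k(x) = (-1)^{x_k}`, where `x = ∑_k x_k 2^{-k-1}` is the binary
expansion of `x ∈ [0,1)` (the terminating one for dyadic rationals, since `Real.digits` is
computed by floors). -/
def rademacher (k : ℕ) (x : ℝ) : ℝ := (-1) ^ (Real.digits x 2 k : ℕ)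

/-- The Walsh–Paley function `ω_n(x) = ∏_k r_k(x)^{n_k}`, where `n = ∑_k n_k 2^k`; the binary
digits `n_k` with `k ≥ n.size` vanish. -/
def walsh (n : ℕ) (x : ℝ) : ℝ :=
  ∏ k ∈ Finset.range n.size, rademacher k x ^ (n.testBit k).toNat

variable {𝕜 : Type*} [RCLike 𝕜]

/-- The Walsh–Fourier coefficient `f̂(i,j) = ∫_{I²} f(x) ω_i(x¹) ω_j(x²) dx`. -/
def walshCoeff (f : ℝ × ℝ → 𝕜) (i j : ℕ) : 𝕜 :=
  ∫ x, f x * ((walsh i x.1 * walsh j x.2 : ℝ) : 𝕜) ∂squareMeasure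

/-- The triangular partial sum
`S_k f(x) = ∑_{i=0}^{k-1} ∑_{j=0}^{k-i-1} f̂(i,j) ω_i(x¹) ω_j(x²)`. -/
def triangularSum (k : ℕ) (f : ℝ × ℝ → 𝕜) (x : ℝ × ℝ) : 𝕜 :=
  ∑ i ∈ Finset.range k, ∑ j ∈ Finset.range (k - i),
    walshCoeff f i j * ((walsh i x.1 * walsh j x.2 : ℝ) : 𝕜)

/-- The triangular Fejér mean `σ_n f = (1/n) ∑_{k=0}^{n-1} S_k f`, used for `n ≥ 1`. -/
def triangularFejer (n : ℕ) (f : ℝ × ℝ → 𝕜) (x : ℝ × ℝ) : 𝕜 :=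
  (n : 𝕜)⁻¹ * ∑ k ∈ Finset.range n, triangularSum k f x

/-- The maximal operator `σ_* f = sup_{n ≥ 1} |σ_n f|`, with values in `[0,∞]`. -/
def maximalFejer (f : ℝ × ℝ → 𝕜) (x : ℝ × ℝ) : ℝ≥0∞ :=
  ⨆ (n : ℕ) (_ : 1 ≤ n), ‖triangularFejer n f x‖ₑ

/-- `T` is of weak type `(L¹, L¹)` on the unit square: `T f` is measurable and
`mes {T f > t} ≤ C ‖f‖₁ / t` for all `f ∈ L¹` and all `t > 0`. -/
def IsWeakTypeOne (T : (ℝ × ℝ → 𝕜) → ℝ × ℝ → ℝ≥0∞) : Prop :=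
  ∃ C : ℝ≥0, ∀ f : ℝ × ℝ → 𝕜, MemLp f 1 squareMeasure →
    AEMeasurable (T f) squareMeasure ∧
    ∀ t : ℝ≥0, 0 < t →
      squareMeasure {x | (t : ℝ≥0∞) < T f x} ≤ C * eLpNorm f 1 squareMeasure / t

/-- `T` is of type `(L^p, L^p)` on the unit square: `T f` is measurable and
`‖T f‖_p ≤ C ‖f‖_p` for all `f ∈ L^p`. -/
def IsStrongType (p : ℝ≥0∞) (T : (ℝ × ℝ → 𝕜) → ℝ × ℝ → ℝ≥0∞) : Prop :=
  ∃ C : ℝ≥0, ∀ f : ℝ × ℝ → 𝕜, MemLp f p squareMeasure →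
    AEMeasurable (T f) squareMeasure ∧
    eLpNorm (T f) p squareMeasure ≤ C * eLpNorm f p squareMeasure

end WalshTriangle

end

/-! Write `D_l` for the Walsh–Dirichlet kernels. The kernel of `n σ_n` is `L_n = ∑_{l ≤ n} D_l ⊗
D_{n-l}` (`dirichletConv`). For `m ≤ 2^A`, cutting this sum at `l = m` and `l = 2^A` writes
`L_{2^A+m}` as terms containing a factor `D_{2^A}` in one of the variables, plus `(ε_A + δ_A) L_m`,
plus a unimodular multiple of `L_{2^A-m}` (`dirichletConv_two_pow_add`).

The modulus `|ε_A + δ_A| = 1 + ε_A δ_A` has mean 1 and is independent of `L_m`. Bounding both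
remainders by the same majorant would let the means double at each level, which loses a logarithm.
The gain is that one of `m`, `2^A - m` is at most `2^(A-1)`: the majorants of `sup_{n ≤ 2^A} |L_n|`
(`convMajorant`) then have means satisfying `a_{A+2} = s_{A+1} + (3/2) a_{A+1} + (1/2) a_A`, where
`s_A = O(2^A)` is the mean of `splitPart`, and the characteristic root `(3 + √17)/4` is below 1.8.
Hence `a_A = O(2^A)`. Off the dyadic square of side `2^-k` at the origin the source term is only
`O((A - k + 2) 2^k)`, so the majorant has mean `O(2^k 1.9^(A-k))` there. Dividing by `n ≥ 2^A` gives
off-square bounds that are summable over `A ≥ k`, with ratio 19/20.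

The weak type bound is then a Calderón–Zygmund argument (`IsDyadicGrid.weak_type`): kernels with
`2^A ≤ n < 2^(A+1)` are constant on squares of side `2^(-A-1)`, so they annihilate the mean-zero
pieces on such squares or smaller ones, and the other pieces are controlled by the off-square sums.
All of this is done on the finite grid of `4^N` squares with constants free of `N`, since `σ_n f`
with `n ≤ 2^N` depends only on the integrals of `f` over these squares. The uniform `L¹` bound of
the kernels gives the case `p = ∞`, and truncation at a height proportional to `t` gives `1 < p <
∞`. -/

noncomputable section

namespace WalshTriangle

/-! ### Walsh–Paley functions and Dirichlet kernels of a sequence of signs -/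

/-- The Walsh–Paley function as a function of the sequence of Rademacher signs. -/
def paley (n : ℕ) (ε : ℕ → ℝ) : ℝ :=
  ∏ k ∈ Finset.range n.size, ε k ^ (n.testBit k).toNat

/-- `ε` takes the values `1` and `-1` only. -/
def IsSign (ε : ℕ → ℝ) : Prop := ∀ k, ε k = 1 ∨ ε k = -1

/-- The Walsh–Dirichlet kernel `D_n = ∑_{i < n} ω_i`. -/
def dirichlet (n : ℕ) (ε : ℕ → ℝ) : ℝ := ∑ i ∈ Finset.range n, paley i ε

/-- The sum `∑_{s ≤ n} D_s`. -/
def dirichletSum (n : ℕ) (ε : ℕ → ℝ) : ℝ := ∑ s ∈ Finset.range (n + 1), dirichlet s ε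

/-- The convolution `∑_{l ≤ n} D_l ⊗ D_{n - l}`, which is `n` times the triangular Fejér kernel. -/
def dirichletConv (n : ℕ) (ε δ : ℕ → ℝ) : ℝ :=
  ∑ l ∈ Finset.range (n + 1), dirichlet l ε * dirichlet (n - l) δ

theorem walsh_eq_paley (n : ℕ) (x : ℝ) : walsh n x = paley n (fun k => rademacher k x) := rfl

theorem paley_eq_prod_range {n N : ℕ} (h : n < 2 ^ N) (ε : ℕ → ℝ) :
    paley n ε = ∏ k ∈ Finset.range N, ε k ^ (n.testBit k).toNat := by
  unfold paley
  apply Finset.prod_subset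
  · exact Finset.range_mono (Nat.size_le.2 h)
  · intro k _ hk
    have : n < 2 ^ k := Nat.size_le.1 (by simpa using hk)
    simp [Nat.testBit_lt_two_pow this]

theorem paley_congr {n N : ℕ} (h : n < 2 ^ N) {ε δ : ℕ → ℝ} (hεδ : ∀ k < N, ε k = δ k) :
    paley n ε = paley n δ := by
  rw [paley_eq_prod_range h, paley_eq_prod_range h]
  exact Finset.prod_congr rfl fun k hk => by rw [hεδ k (Finset.mem_range.1 hk)]

theorem paley_mul (n : ℕ) (ε δ : ℕ → ℝ) :
    paley n (fun k => ε k * δ k) = paley n ε * paley n δ := by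
  simp [paley, mul_pow, Finset.prod_mul_distrib]

@[simp] theorem paley_zero (ε : ℕ → ℝ) : paley 0 ε = 1 := by simp [paley]

theorem paley_two_pow_add {A m : ℕ} (h : m < 2 ^ A) (ε : ℕ → ℝ) :
    paley (2 ^ A + m) ε = ε A * paley m ε := by
  rw [paley_eq_prod_range (N := A + 1) (by rw [pow_succ]; omega), Finset.prod_range_succ,
    paley_eq_prod_range h, Nat.testBit_two_pow_add_eq, Nat.testBit_lt_two_pow h, mul_comm]
  congr 1
  · simp
  · exact Finset.prod_congr rfl fun k hk => by
      rw [Nat.testBit_two_pow_add_gt (Finset.mem_range.1 hk)]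

/-- Subtracting from `2^A - 1` complements the first `A` binary digits, and signs have square 1.
Summed over the index, this gives the reflection formula `dirichlet_two_pow_sub`. -/
theorem paley_two_pow_sub {A m : ℕ} (h : m < 2 ^ A) {ε : ℕ → ℝ} (hε : IsSign ε) :
    paley (2 ^ A - (m + 1)) ε = paley (2 ^ A - 1) ε * paley m ε := by
  have h1 : 2 ^ A - (m + 1) < 2 ^ A := by omega
  have h2 : 2 ^ A - (0 + 1) < 2 ^ A := by omega
  change _ = paley (2 ^ A - (0 + 1)) ε * _
  rw [paley_eq_prod_range h1, paley_eq_prod_range h2, paley_eq_prod_range h,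
    ← Finset.prod_mul_distrib]
  refine Finset.prod_congr rfl fun k hk => ?_
  rw [Nat.testBit_two_pow_sub_succ h, Nat.testBit_two_pow_sub_succ (by positivity)]
  have hk' := Finset.mem_range.1 hk
  rcases hε k with e | e <;> cases m.testBit k <;> simp [e, hk']

theorem abs_paley {ε : ℕ → ℝ} (hε : IsSign ε) (n : ℕ) : |paley n ε| = 1 := by
  rw [paley, Finset.abs_prod]
  refine Finset.prod_eq_one fun k _ => ?_
  rcases hε k with e | e <;> simp [e, abs_pow]

@[simp] theorem dirichlet_zero (ε : ℕ → ℝ) : dirichlet 0 ε = 0 := by simp [dirichlet]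

@[simp] theorem dirichlet_one (ε : ℕ → ℝ) : dirichlet 1 ε = 1 := by simp [dirichlet]

theorem dirichlet_congr {n N : ℕ} (h : n ≤ 2 ^ N) {ε δ : ℕ → ℝ} (hεδ : ∀ k < N, ε k = δ k) :
    dirichlet n ε = dirichlet n δ :=
  Finset.sum_congr rfl fun _ hi => paley_congr ((Finset.mem_range.1 hi).trans_le h) hεδ

theorem dirichlet_two_pow_add {A m : ℕ} (h : m ≤ 2 ^ A) (ε : ℕ → ℝ) :
    dirichlet (2 ^ A + m) ε = dirichlet (2 ^ A) ε + ε A * dirichlet m ε := by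
  rw [dirichlet, Finset.sum_range_add, dirichlet, dirichlet, Finset.mul_sum]
  congr 1
  exact Finset.sum_congr rfl fun i hi =>
    paley_two_pow_add ((Finset.mem_range.1 hi).trans_le h) ε

theorem dirichlet_two_pow_sub {A s : ℕ} (h : s ≤ 2 ^ A) {ε : ℕ → ℝ} (hε : IsSign ε) :
    dirichlet (2 ^ A - s) ε
      = dirichlet (2 ^ A) ε - paley (2 ^ A - 1) ε * dirichlet s ε := by
  induction s with
  | zero => simp
  | succ s ih =>
    have h1 : dirichlet (2 ^ A - s) ε
        = dirichlet (2 ^ A - (s + 1)) ε + paley (2 ^ A - (s + 1)) ε := by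
      rw [show 2 ^ A - s = 2 ^ A - (s + 1) + 1 by omega, dirichlet, Finset.sum_range_succ]; rfl
    have h2 : dirichlet (s + 1) ε = dirichlet s ε + paley s ε := by
      rw [dirichlet, Finset.sum_range_succ]; rfl
    rw [ih (by omega), paley_two_pow_sub (m := s) (by omega) hε] at h1
    rw [h2]; linarith

theorem dirichlet_two_pow_succ (A : ℕ) (ε : ℕ → ℝ) :
    dirichlet (2 ^ (A + 1)) ε = (1 + ε A) * dirichlet (2 ^ A) ε := by
  rw [pow_succ, mul_two, dirichlet_two_pow_add le_rfl]; ring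

theorem dirichlet_two_pow_nonneg {ε : ℕ → ℝ} (hε : IsSign ε) (A : ℕ) :
    0 ≤ dirichlet (2 ^ A) ε := by
  induction A with
  | zero => simp
  | succ A ih =>
    rw [dirichlet_two_pow_succ]
    rcases hε A with e | e <;> rw [e] <;> linarith

theorem dirichlet_two_pow_eq_zero {ε : ℕ → ℝ} (hε : IsSign ε) {A j : ℕ} (hj : j < A)
    (h : ε j ≠ 1) : dirichlet (2 ^ A) ε = 0 := by
  induction A with
  | zero => omega
  | succ A ih =>
    rw [dirichlet_two_pow_succ]
    rcases Nat.lt_succ_iff_lt_or_eq.1 hj with h' | rfl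
    · rw [ih h', mul_zero]
    · rw [(hε j).resolve_left h]; ring

theorem dirichletSum_succ (n : ℕ) (ε : ℕ → ℝ) :
    dirichletSum (n + 1) ε = dirichletSum n ε + dirichlet (n + 1) ε := by
  rw [dirichletSum, Finset.sum_range_succ]; rfl

@[simp] theorem dirichletSum_zero (ε : ℕ → ℝ) : dirichletSum 0 ε = 0 := by simp [dirichletSum]

@[simp] theorem dirichletSum_one (ε : ℕ → ℝ) : dirichletSum 1 ε = 1 := by
  simp [dirichletSum_succ]

theorem dirichletSum_congr {n N : ℕ} (h : n ≤ 2 ^ N) {ε δ : ℕ → ℝ} (hεδ : ∀ k < N, ε k = δ k) :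
    dirichletSum n ε = dirichletSum n δ :=
  Finset.sum_congr rfl fun i hi =>
    dirichlet_congr (by have := Finset.mem_range.1 hi; omega) hεδ

theorem dirichletSum_two_pow_add {A m : ℕ} (h : m ≤ 2 ^ A) (ε : ℕ → ℝ) :
    dirichletSum (2 ^ A + m) ε
      = dirichletSum (2 ^ A) ε + m * dirichlet (2 ^ A) ε + ε A * dirichletSum m ε := by
  induction m with
  | zero => simp
  | succ m ih =>
    rw [← add_assoc, dirichletSum_succ, ih (by omega), dirichletSum_succ, add_assoc (2 ^ A) m 1,
      dirichlet_two_pow_add h]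
    push_cast; ring

theorem dirichletSum_two_pow_succ (A : ℕ) (ε : ℕ → ℝ) :
    dirichletSum (2 ^ (A + 1)) ε
      = (1 + ε A) * dirichletSum (2 ^ A) ε + 2 ^ A * dirichlet (2 ^ A) ε := by
  rw [pow_succ, mul_two, dirichletSum_two_pow_add le_rfl]; push_cast; ring

theorem dirichletSum_two_pow_nonneg {ε : ℕ → ℝ} (hε : IsSign ε) (A : ℕ) :
    0 ≤ dirichletSum (2 ^ A) ε := by
  induction A with
  | zero => simp
  | succ A ih =>
    rw [dirichletSum_two_pow_succ]
    have := dirichlet_two_pow_nonneg hε A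
    have h2 : (0 : ℝ) ≤ 2 ^ A * dirichlet (2 ^ A) ε := by positivity
    rcases hε A with e | e <;> rw [e] <;> linarith

theorem dirichletConv_congr {n N : ℕ} (h : n ≤ 2 ^ N) {ε δ ε' δ' : ℕ → ℝ}
    (hε : ∀ k < N, ε k = ε' k) (hδ : ∀ k < N, δ k = δ' k) :
    dirichletConv n ε δ = dirichletConv n ε' δ' :=
  Finset.sum_congr rfl fun i hi => by
    have := Finset.mem_range.1 hi
    rw [dirichlet_congr (by omega) hε, dirichlet_congr (by omega) hδ]

theorem sum_dirichlet_sub (n : ℕ) (ε : ℕ → ℝ) :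
    ∑ l ∈ Finset.range (n + 1), dirichlet (n - l) ε = dirichletSum n ε := by
  rw [dirichletSum, ← Finset.sum_range_reflect]
  exact Finset.sum_congr rfl fun l hl => by
    have := Finset.mem_range.1 hl
    congr 1; omega

/-- The three blocks overlap at `m` and at `M`. The middle one is listed downwards from `M`, which
is the form needed for reflection. -/
theorem sum_range_split_three {M m : ℕ} (h : m ≤ M) (g : ℕ → ℝ) :
    ∑ l ∈ Finset.range (M + m + 1), g l
      = ∑ l ∈ Finset.range (m + 1), g l + ∑ s ∈ Finset.range (M - m + 1), g (M - s)
        + ∑ s ∈ Finset.range (m + 1), g (M + s) - g m - g M := by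
  obtain ⟨d, rfl⟩ := Nat.exists_eq_add_of_le h
  have e1 : ∑ s ∈ Finset.range (m + d - m + 1), g (m + d - s)
      = ∑ s ∈ Finset.range (d + 1), g (m + s) := by
    rw [show m + d - m + 1 = d + 1 by omega, ← Finset.sum_range_reflect]
    refine Finset.sum_congr rfl fun s hs => ?_
    have := Finset.mem_range.1 hs
    congr 1; omega
  rw [e1, show m + d + m + 1 = m + d + (m + 1) by omega, Finset.sum_range_add,
    Finset.sum_range_add, Finset.sum_range_succ g m, Finset.sum_range_succ _ d]
  ring

/-- In the two outer blocks one index has the form `2^A + s` with `s ≤ m`. In the middle block the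
indices are `2^A - s` and `2^A - (2^A - m - s)`, so reflection applies to both factors and the new
convolution has total index `2^A - m`. -/
theorem dirichletConv_two_pow_add {A m : ℕ} (h : m ≤ 2 ^ A) {ε δ : ℕ → ℝ} (hε : IsSign ε)
    (hδ : IsSign δ) :
    dirichletConv (2 ^ A + m) ε δ
      = dirichlet (2 ^ A) ε * dirichletSum m δ + dirichlet (2 ^ A) δ * dirichletSum m ε
        + (ε A + δ A) * dirichletConv m ε δ
        + ((2 ^ A - m : ℕ) + 1 : ℝ) * (dirichlet (2 ^ A) ε * dirichlet (2 ^ A) δ)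
        - dirichlet (2 ^ A) ε * (paley (2 ^ A - 1) δ * dirichletSum (2 ^ A - m) δ)
        - dirichlet (2 ^ A) δ * (paley (2 ^ A - 1) ε * dirichletSum (2 ^ A - m) ε)
        + paley (2 ^ A - 1) ε * paley (2 ^ A - 1) δ * dirichletConv (2 ^ A - m) ε δ
        - dirichlet m ε * dirichlet (2 ^ A) δ - dirichlet (2 ^ A) ε * dirichlet m δ := by
  rw [dirichletConv, sum_range_split_three h]
  have e1 : ∑ l ∈ Finset.range (m + 1), dirichlet l ε * dirichlet (2 ^ A + m - l) δ
      = dirichlet (2 ^ A) δ * dirichletSum m ε + δ A * dirichletConv m ε δ := by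
    rw [dirichletSum, dirichletConv, Finset.mul_sum, Finset.mul_sum, ← Finset.sum_add_distrib]
    refine Finset.sum_congr rfl fun l hl => ?_
    have := Finset.mem_range.1 hl
    rw [show 2 ^ A + m - l = 2 ^ A + (m - l) by omega, dirichlet_two_pow_add (by omega)]
    ring
  have e3 : ∑ s ∈ Finset.range (m + 1),
        dirichlet (2 ^ A + s) ε * dirichlet (2 ^ A + m - (2 ^ A + s)) δ
      = dirichlet (2 ^ A) ε * dirichletSum m δ + ε A * dirichletConv m ε δ := by
    rw [← sum_dirichlet_sub, dirichletConv, Finset.mul_sum, Finset.mul_sum,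
      ← Finset.sum_add_distrib]
    refine Finset.sum_congr rfl fun l hl => ?_
    have := Finset.mem_range.1 hl
    rw [show 2 ^ A + m - (2 ^ A + l) = m - l by omega, dirichlet_two_pow_add (by omega)]
    ring
  have e2 : ∑ s ∈ Finset.range (2 ^ A - m + 1),
        dirichlet (2 ^ A - s) ε * dirichlet (2 ^ A + m - (2 ^ A - s)) δ
      = ((2 ^ A - m : ℕ) + 1 : ℝ) * (dirichlet (2 ^ A) ε * dirichlet (2 ^ A) δ)
        - dirichlet (2 ^ A) ε * (paley (2 ^ A - 1) δ * dirichletSum (2 ^ A - m) δ)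
        - dirichlet (2 ^ A) δ * (paley (2 ^ A - 1) ε * dirichletSum (2 ^ A - m) ε)
        + paley (2 ^ A - 1) ε * paley (2 ^ A - 1) δ * dirichletConv (2 ^ A - m) ε δ := by
    have c : ((2 ^ A - m : ℕ) + 1 : ℝ) * (dirichlet (2 ^ A) ε * dirichlet (2 ^ A) δ)
        = ∑ s ∈ Finset.range (2 ^ A - m + 1), dirichlet (2 ^ A) ε * dirichlet (2 ^ A) δ := by
      simp
    rw [c, ← sum_dirichlet_sub (2 ^ A - m) δ, dirichletSum, dirichletConv, Finset.mul_sum,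
      Finset.mul_sum, Finset.mul_sum, Finset.mul_sum, Finset.mul_sum, ← Finset.sum_sub_distrib,
      ← Finset.sum_sub_distrib, ← Finset.sum_add_distrib]
    refine Finset.sum_congr rfl fun l hl => ?_
    have := Finset.mem_range.1 hl
    rw [show 2 ^ A + m - (2 ^ A - l) = 2 ^ A - (2 ^ A - m - l) by omega,
      dirichlet_two_pow_sub (by omega) hε, dirichlet_two_pow_sub (by omega) hδ]
    ring
  rw [e1, e2, e3, Nat.add_sub_cancel_left, Nat.add_sub_cancel]
  ring

/-- For fixed `k`, summing over `i` first leaves partial sums of `a` against single terms of `b`;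
summation over `k` then turns those terms into partial sums of `b`. -/
theorem sum_triangle_eq_conv (a b : ℕ → ℝ) (n : ℕ) :
    ∑ k ∈ Finset.range n, ∑ i ∈ Finset.range k, ∑ j ∈ Finset.range (k - i), a i * b j
      = ∑ l ∈ Finset.range (n + 1),
          (∑ i ∈ Finset.range l, a i) * ∑ j ∈ Finset.range (n - l), b j := by
  have key : ∀ n, ∑ i ∈ Finset.range n, ∑ j ∈ Finset.range (n - i), a i * b j
      = ∑ l ∈ Finset.range (n + 1), (∑ i ∈ Finset.range l, a i) * b (n - l) := by
    intro n
    rw [Finset.sum_range_succ', Finset.range_zero, Finset.sum_empty, zero_mul, add_zero]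
    simp_rw [Finset.sum_mul]
    rw [Finset.sum_sigma', Finset.sum_sigma']
    refine Finset.sum_bij' (fun p _ => ⟨n - 1 - p.2, p.1⟩) (fun p _ => ⟨p.2, n - 1 - p.1⟩)
      ?_ ?_ ?_ ?_ ?_
    · rintro ⟨i, j⟩ h; simp only [Finset.mem_sigma, Finset.mem_range] at h ⊢; omega
    · rintro ⟨i, j⟩ h; simp only [Finset.mem_sigma, Finset.mem_range] at h ⊢; omega
    · rintro ⟨i, j⟩ h; simp only [Finset.mem_sigma, Finset.mem_range] at h
      simp only [Sigma.mk.injEq, heq_eq_eq, true_and]; omega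
    · rintro ⟨i, j⟩ h; simp only [Finset.mem_sigma, Finset.mem_range] at h
      simp only [Sigma.mk.injEq, heq_eq_eq, and_true]; omega
    · rintro ⟨i, j⟩ h; simp only [Finset.mem_sigma, Finset.mem_range] at h
      rw [show n - (n - 1 - j + 1) = j by omega]
  induction n with
  | zero => simp
  | succ n ih =>
    rw [Finset.sum_range_succ, ih, key, Finset.sum_range_succ _ (n + 1), Nat.sub_self,
      Finset.range_zero, Finset.sum_empty, mul_zero, add_zero, ← Finset.sum_add_distrib]
    refine Finset.sum_congr rfl fun l hl => ?_
    have := Finset.mem_range.1 hl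
    rw [show n + 1 - l = n - l + 1 by omega, Finset.sum_range_succ]
    ring

theorem sum_triangle_paley (n : ℕ) (ε δ : ℕ → ℝ) :
    ∑ k ∈ Finset.range n, ∑ i ∈ Finset.range k, ∑ j ∈ Finset.range (k - i),
      paley i ε * paley j δ = dirichletConv n ε δ :=
  sum_triangle_eq_conv _ _ n

/-! ### Majorants of the kernels -/

/-- A majorant of `|∑_{s ≤ n} D_s|` over all `n ≤ 2 ^ A`. -/
def sumMajorant : ℕ → (ℕ → ℝ) → ℝ
  | 0, _ => 1
  | A + 1, ε => dirichletSum (2 ^ A) ε + 2 ^ A * dirichlet (2 ^ A) ε + sumMajorant A ε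

/-- The part of the recursion for `dirichletConv` at level `A` which splits into products of
one-dimensional kernels. -/
def splitPart (A : ℕ) (ε δ : ℕ → ℝ) : ℝ :=
  (2 ^ A + 1) * (dirichlet (2 ^ A) ε * dirichlet (2 ^ A) δ)
    + 4 * (dirichlet (2 ^ A) ε * sumMajorant A δ + dirichlet (2 ^ A) δ * sumMajorant A ε)

/-- A majorant of `|dirichletConv n|` over all `n ≤ 2 ^ A`. -/
def convMajorant : ℕ → (ℕ → ℝ) → (ℕ → ℝ) → ℝ
  | 0, _, _ => 0
  | 1, ε, δ => splitPart 0 ε δ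
  | A + 2, ε, δ => splitPart (A + 1) ε δ + convMajorant (A + 1) ε δ
      + (1 + ε (A + 1) * δ (A + 1)) * ((convMajorant (A + 1) ε δ + convMajorant A ε δ) / 2)

theorem sumMajorant_nonneg {ε : ℕ → ℝ} (hε : IsSign ε) (A : ℕ) : 0 ≤ sumMajorant A ε := by
  induction A with
  | zero => simp [sumMajorant]
  | succ A ih =>
    have := dirichlet_two_pow_nonneg hε A
    have := dirichletSum_two_pow_nonneg hε A
    rw [sumMajorant]; positivity

theorem sumMajorant_congr {A N : ℕ} (h : A ≤ N) {ε δ : ℕ → ℝ} (hεδ : ∀ k < N, ε k = δ k) :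
    sumMajorant A ε = sumMajorant A δ := by
  induction A with
  | zero => rfl
  | succ A ih =>
    have : 2 ^ A ≤ 2 ^ N := Nat.pow_le_pow_right (by norm_num) (by omega)
    rw [sumMajorant, sumMajorant, ih (by omega), dirichlet_congr this hεδ,
      dirichletSum_congr this hεδ]

theorem abs_dirichletSum_le {ε : ℕ → ℝ} (hε : IsSign ε) {A n : ℕ} (h : n ≤ 2 ^ A) :
    |dirichletSum n ε| ≤ sumMajorant A ε := by
  induction A generalizing n with
  | zero =>
    rw [pow_zero] at h
    interval_cases n <;> simp [sumMajorant]
  | succ A ih =>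
    have hD := dirichlet_two_pow_nonneg hε A
    have hE := dirichletSum_two_pow_nonneg hε A
    have hΨ := sumMajorant_nonneg hε A
    rw [sumMajorant]
    rcases le_total n (2 ^ A) with h' | h'
    · have : (0 : ℝ) ≤ 2 ^ A * dirichlet (2 ^ A) ε := by positivity
      linarith [ih h']
    · obtain ⟨m, rfl⟩ := Nat.exists_eq_add_of_le h'
      have hm : m ≤ 2 ^ A := by rw [pow_succ] at h; omega
      have hm' : (m : ℝ) ≤ 2 ^ A := by exact_mod_cast hm
      rw [dirichletSum_two_pow_add hm]
      have h1 : |ε A * dirichletSum m ε| ≤ sumMajorant A ε := by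
        rcases hε A with e | e <;> simpa [e] using ih hm
      have h2 : (m : ℝ) * dirichlet (2 ^ A) ε ≤ 2 ^ A * dirichlet (2 ^ A) ε :=
        mul_le_mul_of_nonneg_right hm' hD
      have h3 : (0 : ℝ) ≤ m * dirichlet (2 ^ A) ε := by positivity
      rw [abs_le] at h1 ⊢
      constructor <;> linarith

/-- A Dirichlet kernel is the difference of two consecutive `dirichletSum`s. -/
theorem abs_dirichlet_le {ε : ℕ → ℝ} (hε : IsSign ε) {A n : ℕ} (h : n ≤ 2 ^ A) :
    |dirichlet n ε| ≤ 2 * sumMajorant A ε := by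
  rcases n with _ | n
  · simpa using sumMajorant_nonneg hε A
  · have h1 := abs_dirichletSum_le hε h
    have h2 := abs_dirichletSum_le hε (n := n) (by omega : n ≤ 2 ^ A)
    have h3 := dirichletSum_succ n ε
    rw [abs_le] at h1 h2 ⊢
    constructor <;> linarith

theorem splitPart_nonneg {ε δ : ℕ → ℝ} (hε : IsSign ε) (hδ : IsSign δ) (A : ℕ) :
    0 ≤ splitPart A ε δ := by
  have := dirichlet_two_pow_nonneg hε A
  have := dirichlet_two_pow_nonneg hδ A
  have := sumMajorant_nonneg hε A
  have := sumMajorant_nonneg hδ A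
  unfold splitPart; positivity

theorem splitPart_congr {A N : ℕ} (h : A ≤ N) {ε δ ε' δ' : ℕ → ℝ}
    (hε : ∀ k < N, ε k = ε' k) (hδ : ∀ k < N, δ k = δ' k) :
    splitPart A ε δ = splitPart A ε' δ' := by
  have : 2 ^ A ≤ 2 ^ N := Nat.pow_le_pow_right (by norm_num) h
  rw [splitPart, splitPart, dirichlet_congr this hε, dirichlet_congr this hδ,
    sumMajorant_congr h hε, sumMajorant_congr h hδ]

theorem IsSign.one_add_mul_nonneg {ε δ : ℕ → ℝ} (hε : IsSign ε) (hδ : IsSign δ) (A : ℕ) :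
    0 ≤ 1 + ε A * δ A := by
  rcases hε A with e | e <;> rcases hδ A with d | d <;> rw [e, d] <;> norm_num

theorem convMajorant_nonneg {ε δ : ℕ → ℝ} (hε : IsSign ε) (hδ : IsSign δ) (A : ℕ) :
    0 ≤ convMajorant A ε δ := by
  induction A using Nat.twoStepInduction with
  | zero => simp [convMajorant]
  | one => exact splitPart_nonneg hε hδ 0
  | more A ih1 ih2 =>
    have := splitPart_nonneg hε hδ (A + 1)
    have := hε.one_add_mul_nonneg hδ (A + 1)
    rw [convMajorant]; positivity

theorem convMajorant_congr {A N : ℕ} (h : A ≤ N) {ε δ ε' δ' : ℕ → ℝ}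
    (hε : ∀ k < N, ε k = ε' k) (hδ : ∀ k < N, δ k = δ' k) :
    convMajorant A ε δ = convMajorant A ε' δ' := by
  induction A using Nat.twoStepInduction with
  | zero => rfl
  | one => exact splitPart_congr (by omega) hε hδ
  | more A ih1 ih2 =>
    rw [convMajorant, convMajorant, ih1 (by omega), ih2 (by omega),
      splitPart_congr (by omega) hε hδ, hε (A + 1) (by omega), hδ (A + 1) (by omega)]

theorem convMajorant_le_succ {ε δ : ℕ → ℝ} (hε : IsSign ε) (hδ : IsSign δ) (A : ℕ) :
    convMajorant A ε δ ≤ convMajorant (A + 1) ε δ := by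
  rcases A with _ | A
  · exact splitPart_nonneg hε hδ 0
  · rw [convMajorant]
    have := splitPart_nonneg hε hδ (A + 1)
    have := hε.one_add_mul_nonneg hδ (A + 1)
    have := convMajorant_nonneg hε hδ A
    have := convMajorant_nonneg hε hδ (A + 1)
    have : 0 ≤ (1 + ε (A + 1) * δ (A + 1))
      * ((convMajorant (A + 1) ε δ + convMajorant A ε δ) / 2) := by positivity
    linarith

/-- The factor 4 in `splitPart` arises because each `D_{2^A}` multiplies two `dirichletSum`s, each
at most one majorant, and one Dirichlet kernel, at most two majorants. -/
theorem abs_dirichletConv_two_pow_add_le {A m : ℕ} (h : m ≤ 2 ^ A) {ε δ : ℕ → ℝ}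
    (hε : IsSign ε) (hδ : IsSign δ) :
    |dirichletConv (2 ^ A + m) ε δ| ≤ splitPart A ε δ
      + (1 + ε A * δ A) * |dirichletConv m ε δ| + |dirichletConv (2 ^ A - m) ε δ| := by
  rw [dirichletConv_two_pow_add h hε hδ, splitPart]
  have a1 := dirichlet_two_pow_nonneg hε A
  have a2 := dirichlet_two_pow_nonneg hδ A
  generalize dirichlet (2 ^ A) ε = Dε at *
  generalize dirichlet (2 ^ A) δ = Dδ at *
  have hM : 2 ^ A - m ≤ 2 ^ A := Nat.sub_le _ _
  have b1 := mul_le_mul_of_nonneg_left (abs_dirichletSum_le hδ h) a1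
  have b2 := mul_le_mul_of_nonneg_left (abs_dirichletSum_le hε h) a2
  have b3 := mul_le_mul_of_nonneg_left (abs_dirichletSum_le hδ hM) a1
  have b4 := mul_le_mul_of_nonneg_left (abs_dirichletSum_le hε hM) a2
  have b5 := mul_le_mul_of_nonneg_left (abs_dirichlet_le hδ h) a1
  have b6 := mul_le_mul_of_nonneg_left (abs_dirichlet_le hε h) a2
  have c : ((2 ^ A - m : ℕ) : ℝ) + 1 ≤ 2 ^ A + 1 := by
    have : ((2 ^ A - m : ℕ) : ℝ) ≤ ((2 ^ A : ℕ) : ℝ) := Nat.cast_le.2 hM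
    push_cast at this ⊢; linarith
  have b7 := mul_le_mul_of_nonneg_right c (mul_nonneg a1 a2)
  have d : |ε A + δ A| = 1 + ε A * δ A := by
    rcases hε A with e | e <;> rcases hδ A with d | d <;> rw [e, d] <;> norm_num
  have w1 := abs_paley hε (2 ^ A - 1)
  have w2 := abs_paley hδ (2 ^ A - 1)
  have e1 : |Dε * dirichletSum m δ| = Dε * |dirichletSum m δ| := by
    rw [abs_mul, abs_of_nonneg a1]
  have e2 : |Dδ * dirichletSum m ε| = Dδ * |dirichletSum m ε| := by
    rw [abs_mul, abs_of_nonneg a2]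
  have e3 : |(ε A + δ A) * dirichletConv m ε δ| = (1 + ε A * δ A) * |dirichletConv m ε δ| := by
    rw [abs_mul, d]
  have e4 : |(((2 ^ A - m : ℕ) : ℝ) + 1) * (Dε * Dδ)| = (((2 ^ A - m : ℕ) : ℝ) + 1) * (Dε * Dδ) :=
    abs_of_nonneg (by positivity)
  have e5 : |Dε * (paley (2 ^ A - 1) δ * dirichletSum (2 ^ A - m) δ)|
      = Dε * |dirichletSum (2 ^ A - m) δ| := by
    rw [abs_mul, abs_mul, w2, one_mul, abs_of_nonneg a1]
  have e6 : |Dδ * (paley (2 ^ A - 1) ε * dirichletSum (2 ^ A - m) ε)|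
      = Dδ * |dirichletSum (2 ^ A - m) ε| := by
    rw [abs_mul, abs_mul, w1, one_mul, abs_of_nonneg a2]
  have e7 : |paley (2 ^ A - 1) ε * paley (2 ^ A - 1) δ * dirichletConv (2 ^ A - m) ε δ|
      = |dirichletConv (2 ^ A - m) ε δ| := by
    rw [abs_mul, abs_mul, w1, w2, one_mul, one_mul]
  have e8 : |dirichlet m ε * Dδ| = Dδ * |dirichlet m ε| := by
    rw [abs_mul, abs_of_nonneg a2, mul_comm]
  have e9 : |Dε * dirichlet m δ| = Dε * |dirichlet m δ| := by
    rw [abs_mul, abs_of_nonneg a1]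
  obtain ⟨l1, u1⟩ := abs_le.1 e1.le
  obtain ⟨l2, u2⟩ := abs_le.1 e2.le
  obtain ⟨l3, u3⟩ := abs_le.1 e3.le
  obtain ⟨l4, u4⟩ := abs_le.1 e4.le
  obtain ⟨l5, u5⟩ := abs_le.1 e5.le
  obtain ⟨l6, u6⟩ := abs_le.1 e6.le
  obtain ⟨l7, u7⟩ := abs_le.1 e7.le
  obtain ⟨l8, u8⟩ := abs_le.1 e8.le
  obtain ⟨l9, u9⟩ := abs_le.1 e9.le
  rw [abs_le]
  constructor <;> linarith

/-- When `ε δ = -1` at the top level, only the reflected remainder survives. When `ε δ = 1`, the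
remainders enter with weights 2 and 1; one of the two indices lies a level lower, so the worst total
is twice the higher majorant plus the lower one, which is what the average in `convMajorant`
provides. The recursion starts from 0 because `L_0 = L_1 = 0`. -/
theorem abs_dirichletConv_le {ε δ : ℕ → ℝ} (hε : IsSign ε) (hδ : IsSign δ) {A n : ℕ}
    (h : n ≤ 2 ^ A) : |dirichletConv n ε δ| ≤ convMajorant A ε δ := by
  have small : ∀ n ≤ 1, dirichletConv n ε δ = 0 := by
    intro n hn
    interval_cases n <;> simp [dirichletConv, Finset.sum_range_succ]
  induction A using Nat.strong_induction_on generalizing n with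
  | _ A ih =>
  rcases A with _ | A
  · rw [small n (by simpa using h)]; simp [convMajorant]
  rcases le_total n (2 ^ A) with h' | h'
  · exact (ih A (by omega) h').trans (convMajorant_le_succ hε hδ A)
  obtain ⟨m, rfl⟩ := Nat.exists_eq_add_of_le h'
  have hm : m ≤ 2 ^ A := by rw [pow_succ] at h; omega
  refine (abs_dirichletConv_two_pow_add_le hm hε hδ).trans ?_
  rcases A with _ | A
  · rw [pow_zero] at hm
    rw [small m hm, small (2 ^ 0 - m) (by simp)]
    simp [convMajorant]
  · rw [convMajorant]
    have g1 := ih (A + 1) (by omega) hm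
    have g2 := ih (A + 1) (by omega) (Nat.sub_le (2 ^ (A + 1)) m)
    have mono := convMajorant_le_succ hε hδ A
    have pos := convMajorant_nonneg hε hδ A
    have n1 := abs_nonneg (dirichletConv m ε δ)
    have n2 := abs_nonneg (dirichletConv (2 ^ (A + 1) - m) ε δ)
    rcases le_total m (2 ^ A) with hmA | hmA
    · have g3 := ih A (by omega) hmA
      rcases hε (A + 1) with e | e <;> rcases hδ (A + 1) with d | d <;> rw [e, d] <;>
        linarith
    · have g3 := ih A (by omega) (n := 2 ^ (A + 1) - m) (by rw [pow_succ]; omega)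
      rcases hε (A + 1) with e | e <;> rcases hδ (A + 1) with d | d <;> rw [e, d] <;>
        linarith

/-! ### Averages over finite sign vectors -/

/-- Vectors of `N` signs. They label the dyadic intervals of length `2 ^ (-N)`. -/
abbrev SignVec (N : ℕ) : Type := Fin N → ℤˣ

/-- The sequence of signs which extends a sign vector by `1`. -/
def signs {N : ℕ} (x : SignVec N) (k : ℕ) : ℝ :=
  if h : k < N then ((x ⟨k, h⟩ : ℤ) : ℝ) else 1

theorem isSign_signs {N : ℕ} (x : SignVec N) : IsSign (signs x) := by
  intro k
  unfold signs
  split_ifs with h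
  · rcases Int.units_eq_one_or (x ⟨k, h⟩) with e | e <;> simp [e]
  · exact Or.inl rfl

theorem signs_mul {N : ℕ} (x y : SignVec N) :
    signs (x * y) = fun k => signs x k * signs y k := by
  funext k
  unfold signs
  split_ifs <;> simp

/-- Flipping the sign number `A` permutes the sign vectors, preserves `h` and changes the sign of
the summand. -/
theorem sum_mul_signs_eq_zero {N A : ℕ} (hA : A < N) (h : (ℕ → ℝ) → ℝ)
    (hh : ∀ ε δ : ℕ → ℝ, (∀ k < A, ε k = δ k) → h ε = h δ) :
    ∑ x : SignVec N, signs x A * h (signs x) = 0 := by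
  let u : SignVec N := Pi.mulSingle ⟨A, hA⟩ (-1)
  have hu : ∀ k, k ≠ A → signs u k = 1 := by
    intro k hk
    unfold signs
    split_ifs with hkN
    · have : (⟨k, hkN⟩ : Fin N) ≠ ⟨A, hA⟩ := fun e => hk (Fin.mk.inj_iff.1 e)
      simp [u, Pi.mulSingle_eq_of_ne this]
    · rfl
  have huA : signs u A = -1 := by simp [signs, hA, u]
  have key := Equiv.sum_comp (Equiv.mulRight u) fun x : SignVec N => signs x A * h (signs x)
  have : ∀ x : SignVec N, signs (x * u) A * h (signs (x * u)) = -(signs x A * h (signs x)) := by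
    intro x
    rw [hh (signs (x * u)) (signs x), signs_mul]
    · simp [huA]
    · intro k hk
      rw [signs_mul]; simp [hu k hk.ne]
  simp only [Equiv.coe_mulRight, this, Finset.sum_neg_distrib] at key
  linarith

theorem sum_one_add_signs_mul {N A : ℕ} (hA : A < N) (h : (ℕ → ℝ) → ℝ)
    (hh : ∀ ε δ : ℕ → ℝ, (∀ k < A, ε k = δ k) → h ε = h δ) :
    ∑ x : SignVec N, (1 + signs x A) * h (signs x) = ∑ x : SignVec N, h (signs x) := by
  simp_rw [add_mul, one_mul, Finset.sum_add_distrib]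
  rw [sum_mul_signs_eq_zero hA h hh, add_zero]

/-- Averaging over `x` alone, with `y` fixed, already removes the term with the two signs, so `h`
may depend on its second argument arbitrarily. -/
theorem sum_one_add_signs_mul_signs_mul {N A : ℕ} (hA : A < N) (h : (ℕ → ℝ) → (ℕ → ℝ) → ℝ)
    (hh : ∀ ε ε' δ : ℕ → ℝ, (∀ k < A, ε k = ε' k) → h ε δ = h ε' δ) :
    ∑ x : SignVec N, ∑ y : SignVec N, (1 + signs x A * signs y A) * h (signs x) (signs y)
      = ∑ x : SignVec N, ∑ y : SignVec N, h (signs x) (signs y) := by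
  simp_rw [add_mul, one_mul, Finset.sum_add_distrib]
  rw [Finset.sum_comm (f := fun x y : SignVec N => signs x A * signs y A * h (signs x) (signs y))]
  rw [add_eq_left]
  refine Finset.sum_eq_zero fun y _ => ?_
  have := sum_mul_signs_eq_zero hA (fun ε => h ε (signs y)) fun ε δ e => hh ε δ _ e
  calc _ = signs y A * ∑ x : SignVec N, signs x A * h (signs x) (signs y) := by
        rw [Finset.mul_sum]; exact Finset.sum_congr rfl fun x _ => by ring
    _ = 0 := by rw [this, mul_zero]

theorem sum_dirichlet_two_pow {N A : ℕ} (hA : A ≤ N) :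
    ∑ x : SignVec N, dirichlet (2 ^ A) (signs x) = 2 ^ N := by
  induction A with
  | zero => simp
  | succ A ih =>
    simp_rw [dirichlet_two_pow_succ]
    rw [sum_one_add_signs_mul hA (dirichlet (2 ^ A)) fun _ _ e => dirichlet_congr le_rfl e,
      ih (by omega)]

theorem sum_dirichletSum_two_pow {N A : ℕ} (hA : A ≤ N) :
    ∑ x : SignVec N, dirichletSum (2 ^ A) (signs x) = 2 ^ A * 2 ^ N := by
  induction A with
  | zero => simp
  | succ A ih =>
    simp_rw [dirichletSum_two_pow_succ, Finset.sum_add_distrib, ← Finset.mul_sum]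
    rw [sum_one_add_signs_mul hA (dirichletSum (2 ^ A))
      fun _ _ e => dirichletSum_congr le_rfl e, ih (by omega), sum_dirichlet_two_pow (by omega)]
    ring

theorem sum_sumMajorant_le {N A : ℕ} (hA : A ≤ N) :
    ∑ x : SignVec N, sumMajorant A (signs x) ≤ 2 * 2 ^ A * 2 ^ N := by
  suffices h : ∑ x : SignVec N, sumMajorant A (signs x) = (2 * 2 ^ A - 1) * 2 ^ N by
    rw [h]; nlinarith [pow_pos (two_pos : (0 : ℝ) < 2) N]
  induction A with
  | zero => simp [sumMajorant]; norm_num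
  | succ A ih =>
    simp_rw [sumMajorant, Finset.sum_add_distrib, ← Finset.mul_sum]
    rw [ih (by omega), sum_dirichletSum_two_pow (by omega), sum_dirichlet_two_pow (by omega)]
    ring

open Classical in
/-- The indicator of the set where one of the first `k` signs is not `1`. -/
def far (k : ℕ) (ε : ℕ → ℝ) : ℝ := if ∀ j < k, ε j = 1 then 0 else 1

open Classical in
/-- The indicator of the set of pairs where one of the first `k` signs is not `1`. -/
def farPair (k : ℕ) (ε δ : ℕ → ℝ) : ℝ := if (∀ j < k, ε j = 1) ∧ ∀ j < k, δ j = 1 then 0 else 1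

theorem far_le_one (k : ℕ) (ε : ℕ → ℝ) : far k ε ≤ 1 := by
  unfold far; split_ifs <;> norm_num

theorem farPair_nonneg (k : ℕ) (ε δ : ℕ → ℝ) : 0 ≤ farPair k ε δ := by
  unfold farPair; split_ifs <;> norm_num

theorem farPair_le_one (k : ℕ) (ε δ : ℕ → ℝ) : farPair k ε δ ≤ 1 := by
  unfold farPair; split_ifs <;> norm_num

theorem far_congr {k N : ℕ} (h : k ≤ N) {ε δ : ℕ → ℝ} (hεδ : ∀ j < N, ε j = δ j) :
    far k ε = far k δ := by
  have : (∀ j < k, ε j = 1) ↔ ∀ j < k, δ j = 1 :=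
    forall₂_congr fun j hj => by rw [hεδ j (by omega)]
  simp only [far, this]

theorem farPair_congr_left {k N : ℕ} (h : k ≤ N) {ε ε' : ℕ → ℝ} (δ : ℕ → ℝ)
    (hε : ∀ j < N, ε j = ε' j) : farPair k ε δ = farPair k ε' δ := by
  have : (∀ j < k, ε j = 1) ↔ ∀ j < k, ε' j = 1 :=
    forall₂_congr fun j hj => by rw [hε j (by omega)]
  simp only [farPair, this]

theorem farPair_comm (k : ℕ) (ε δ : ℕ → ℝ) : farPair k ε δ = farPair k δ ε := by
  unfold farPair; congr 1; exact propext and_comm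

theorem far_mul_dirichlet {ε : ℕ → ℝ} (hε : IsSign ε) {k A : ℕ} (h : k ≤ A) :
    far k ε * dirichlet (2 ^ A) ε = 0 := by
  unfold far
  split_ifs with hk
  · simp
  · push Not at hk
    obtain ⟨j, hj, hj'⟩ := hk
    rw [dirichlet_two_pow_eq_zero hε (by omega) hj', mul_zero]

/-- On the support of `D_{2^A}` the first `k` signs of `ε` are 1, so being far must come from `δ`.
-/
theorem farPair_mul_dirichlet {ε : ℕ → ℝ} (hε : IsSign ε) (δ : ℕ → ℝ) {k A : ℕ} (h : k ≤ A) :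
    farPair k ε δ * dirichlet (2 ^ A) ε = dirichlet (2 ^ A) ε * far k δ := by
  by_cases hk : ∀ j < k, ε j = 1
  · have : farPair k ε δ = far k δ := if_congr (and_iff_right hk) rfl rfl
    rw [this, mul_comm]
  · push Not at hk
    obtain ⟨j, hj, hj'⟩ := hk
    rw [dirichlet_two_pow_eq_zero hε (by omega) hj', mul_zero, zero_mul]

/-- Off the interval of level `k` the Dirichlet term of `dirichletSum_two_pow_succ` vanishes. What
remains is multiplication by `1 + ε_A`, which preserves means, so there is no growth beyond level
`k`. -/
theorem sum_far_mul_dirichletSum_le {N k i : ℕ} (h : k + i ≤ N) :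
    ∑ x : SignVec N, far k (signs x) * dirichletSum (2 ^ (k + i)) (signs x) ≤ 2 ^ k * 2 ^ N := by
  induction i with
  | zero =>
    rw [← sum_dirichletSum_two_pow (show k ≤ N by omega)]
    refine Finset.sum_le_sum fun x _ => ?_
    exact mul_le_of_le_one_left (dirichletSum_two_pow_nonneg (isSign_signs x) _) (far_le_one _ _)
  | succ i ih =>
    refine le_trans (le_of_eq ?_) (ih (by omega))
    rw [← sum_one_add_signs_mul (A := k + i) (by omega)
      (fun ε => far k ε * dirichletSum (2 ^ (k + i)) ε)
      fun _ _ e => by rw [far_congr (by omega) e, dirichletSum_congr le_rfl e]]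
    refine Finset.sum_congr rfl fun x _ => ?_
    rw [← add_assoc, dirichletSum_two_pow_succ]
    linear_combination 2 ^ (k + i) * far_mul_dirichlet (isSign_signs x) (show k ≤ k + i by omega)

theorem sum_far_mul_sumMajorant_le {N k i : ℕ} (h : k + i ≤ N) :
    ∑ x : SignVec N, far k (signs x) * sumMajorant (k + i) (signs x)
      ≤ (i + 2) * 2 ^ k * 2 ^ N := by
  induction i with
  | zero =>
    have := sum_sumMajorant_le (show k ≤ N by omega)
    rw [Nat.cast_zero, zero_add]
    refine le_trans (Finset.sum_le_sum fun x _ => ?_) this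
    exact mul_le_of_le_one_left (sumMajorant_nonneg (isSign_signs x) _) (far_le_one _ _)
  | succ i ih =>
    have h1 := ih (by omega)
    have h2 := sum_far_mul_dirichletSum_le (N := N) (k := k) (i := i) (by omega)
    have : ∀ x : SignVec N, far k (signs x) * sumMajorant (k + (i + 1)) (signs x)
        = far k (signs x) * dirichletSum (2 ^ (k + i)) (signs x)
          + far k (signs x) * sumMajorant (k + i) (signs x) := by
      intro x
      rw [← add_assoc, sumMajorant]
      linear_combination 2 ^ (k + i) * far_mul_dirichlet (isSign_signs x)
        (show k ≤ k + i by omega)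
    simp_rw [this, Finset.sum_add_distrib]
    push_cast
    linarith

theorem sum_sum_splitPart_le {N A : ℕ} (hA : A ≤ N) :
    ∑ x : SignVec N, ∑ y : SignVec N, splitPart A (signs x) (signs y) ≤ 18 * 2 ^ A * 4 ^ N := by
  have h1 := sum_dirichlet_two_pow hA
  have h2 := sum_sumMajorant_le hA
  have e : ∑ x : SignVec N, ∑ y : SignVec N, splitPart A (signs x) (signs y)
      = (2 ^ A + 1) * ((∑ x : SignVec N, dirichlet (2 ^ A) (signs x))
          * ∑ x : SignVec N, dirichlet (2 ^ A) (signs x))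
        + 8 * ((∑ x : SignVec N, dirichlet (2 ^ A) (signs x))
          * ∑ x : SignVec N, sumMajorant A (signs x)) := by
    have c : ∑ x : SignVec N, ∑ y : SignVec N,
        dirichlet (2 ^ A) (signs y) * sumMajorant A (signs x)
        = (∑ x : SignVec N, dirichlet (2 ^ A) (signs x))
          * ∑ x : SignVec N, sumMajorant A (signs x) := by
      rw [Finset.sum_mul_sum, Finset.sum_comm]
    simp only [splitPart, Finset.sum_add_distrib, ← Finset.mul_sum, c]
    simp only [← Finset.sum_mul]
    ring
  rw [e, h1]
  have p : (0 : ℝ) < 2 ^ N := by positivity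
  have q : (1 : ℝ) ≤ 2 ^ A := one_le_pow₀ (by norm_num)
  have r : (4 : ℝ) ^ N = 2 ^ N * 2 ^ N := by rw [← mul_pow]; norm_num
  have h3 := mul_le_mul_of_nonneg_left h2 p.le
  have h4 := mul_le_mul_of_nonneg_right q (mul_pos p p).le
  rw [r]
  nlinarith

/-- The product of the two Dirichlet kernels vanishes off the square. In each mixed product the far
condition passes to the majorant, whose mean grows only linearly in `i`. -/
theorem sum_sum_farPair_mul_splitPart_le {N k i : ℕ} (h : k + i ≤ N) :
    ∑ x : SignVec N, ∑ y : SignVec N,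
        farPair k (signs x) (signs y) * splitPart (k + i) (signs x) (signs y)
      ≤ 8 * (i + 2) * 2 ^ k * 4 ^ N := by
  have h1 := sum_dirichlet_two_pow h
  have h2 := sum_far_mul_sumMajorant_le h
  have e : ∑ x : SignVec N, ∑ y : SignVec N,
        farPair k (signs x) (signs y) * splitPart (k + i) (signs x) (signs y)
      = 8 * ((∑ x : SignVec N, dirichlet (2 ^ (k + i)) (signs x))
          * ∑ x : SignVec N, far k (signs x) * sumMajorant (k + i) (signs x)) := by
    have c : ∑ x : SignVec N, ∑ y : SignVec N,
        dirichlet (2 ^ (k + i)) (signs y) * (far k (signs x) * sumMajorant (k + i) (signs x))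
        = (∑ x : SignVec N, dirichlet (2 ^ (k + i)) (signs x))
          * ∑ x : SignVec N, far k (signs x) * sumMajorant (k + i) (signs x) := by
      rw [Finset.sum_mul_sum, Finset.sum_comm]
    have pt : ∀ x y : SignVec N,
        farPair k (signs x) (signs y) * splitPart (k + i) (signs x) (signs y)
        = 4 * (dirichlet (2 ^ (k + i)) (signs x)
              * (far k (signs y) * sumMajorant (k + i) (signs y)))
          + 4 * (dirichlet (2 ^ (k + i)) (signs y)
              * (far k (signs x) * sumMajorant (k + i) (signs x))) := by
      intro x y
      have a1 := farPair_mul_dirichlet (isSign_signs x) (signs y) (show k ≤ k + i by omega)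
      have a2 := farPair_mul_dirichlet (isSign_signs y) (signs x) (show k ≤ k + i by omega)
      have a3 := far_mul_dirichlet (isSign_signs y) (show k ≤ k + i by omega)
      rw [farPair_comm] at a2
      rw [splitPart]
      linear_combination ((2 ^ (k + i) + 1) * dirichlet (2 ^ (k + i)) (signs y)
        + 4 * sumMajorant (k + i) (signs y)) * a1 + 4 * sumMajorant (k + i) (signs x) * a2
        + (2 ^ (k + i) + 1) * dirichlet (2 ^ (k + i)) (signs x) * a3
    simp only [pt, Finset.sum_add_distrib, ← Finset.mul_sum, c]
    simp only [← Finset.sum_mul]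
    ring
  rw [e, h1]
  have p : (0 : ℝ) < 2 ^ N := by positivity
  have r : (4 : ℝ) ^ N = 2 ^ N * 2 ^ N := by rw [← mul_pow]; norm_num
  have h3 := mul_le_mul_of_nonneg_left h2 p.le
  rw [r]
  linarith

/-- The weight `w` allows the same recursion to be used on the whole square (`w = 1`) and off a
smaller square (`w = farPair k`). -/
theorem sum_sum_mul_convMajorant_add_two {N A : ℕ} (hA : A + 2 ≤ N)
    (w : (ℕ → ℝ) → (ℕ → ℝ) → ℝ)
    (hw : ∀ ε ε' δ : ℕ → ℝ, (∀ j < A + 1, ε j = ε' j) → w ε δ = w ε' δ) :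
    ∑ x : SignVec N, ∑ y : SignVec N,
        w (signs x) (signs y) * convMajorant (A + 2) (signs x) (signs y)
      = ∑ x : SignVec N, ∑ y : SignVec N,
          w (signs x) (signs y) * splitPart (A + 1) (signs x) (signs y)
        + 3 / 2 * ∑ x : SignVec N, ∑ y : SignVec N,
          w (signs x) (signs y) * convMajorant (A + 1) (signs x) (signs y)
        + 1 / 2 * ∑ x : SignVec N, ∑ y : SignVec N,
          w (signs x) (signs y) * convMajorant A (signs x) (signs y) := by
  have key := sum_one_add_signs_mul_signs_mul (N := N) (A := A + 1) (by omega)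
    (fun ε δ => w ε δ * ((convMajorant (A + 1) ε δ + convMajorant A ε δ) / 2))
    fun ε ε' δ e => by
      rw [hw ε ε' δ e, convMajorant_congr le_rfl e fun _ _ => rfl,
        convMajorant_congr (Nat.le_succ A) e fun _ _ => rfl]
  have e1 : ∑ x : SignVec N, ∑ y : SignVec N,
        w (signs x) (signs y) * convMajorant (A + 2) (signs x) (signs y)
      = ∑ x : SignVec N, ∑ y : SignVec N,
          w (signs x) (signs y) * splitPart (A + 1) (signs x) (signs y)
        + ∑ x : SignVec N, ∑ y : SignVec N,
          w (signs x) (signs y) * convMajorant (A + 1) (signs x) (signs y)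
        + ∑ x : SignVec N, ∑ y : SignVec N, (1 + signs x (A + 1) * signs y (A + 1)) *
          (w (signs x) (signs y) * ((convMajorant (A + 1) (signs x) (signs y)
            + convMajorant A (signs x) (signs y)) / 2)) := by
    simp only [← Finset.sum_add_distrib]
    refine Finset.sum_congr rfl fun x _ => Finset.sum_congr rfl fun y _ => ?_
    rw [convMajorant]; ring
  have e2 : ∑ x : SignVec N, ∑ y : SignVec N,
        w (signs x) (signs y) * ((convMajorant (A + 1) (signs x) (signs y)
            + convMajorant A (signs x) (signs y)) / 2)
      = 1 / 2 * ∑ x : SignVec N, ∑ y : SignVec N,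
          w (signs x) (signs y) * convMajorant (A + 1) (signs x) (signs y)
        + 1 / 2 * ∑ x : SignVec N, ∑ y : SignVec N,
          w (signs x) (signs y) * convMajorant A (signs x) (signs y) := by
    simp only [Finset.mul_sum, ← Finset.sum_add_distrib]
    refine Finset.sum_congr rfl fun x _ => Finset.sum_congr rfl fun y _ => ?_
    ring
  rw [e1, key, e2]
  ring

/-- With weight 3/10 on the lower term, one step multiplies the combination by at most 1.8, since
`3/2 + 3/10 = 1.8` and `1/2 ≤ 1.8 · 3/10`. The constant 180 balances the source: `18 · 2 + 1.8 · 180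
= 2 · 180`. -/
theorem sum_sum_convMajorant_pair_le {N A : ℕ} (hA : A + 1 ≤ N) :
    ∑ x : SignVec N, ∑ y : SignVec N, convMajorant (A + 1) (signs x) (signs y)
      + 3 / 10 * ∑ x : SignVec N, ∑ y : SignVec N, convMajorant A (signs x) (signs y)
      ≤ 180 * 2 ^ A * 4 ^ N := by
  have p : (0 : ℝ) < 4 ^ N := by positivity
  induction A with
  | zero =>
    have := sum_sum_splitPart_le (N := N) (A := 0) (by omega)
    simp only [convMajorant, Finset.sum_const_zero, mul_zero, add_zero]
    linarith
  | succ A ih =>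
    have h1 := ih (by omega)
    have h2 := sum_sum_splitPart_le (N := N) (A := A + 1) (by omega)
    have h3 := sum_sum_mul_convMajorant_add_two hA (fun _ _ => 1) fun _ _ _ _ => rfl
    have h4 : (0 : ℝ) ≤ ∑ x : SignVec N, ∑ y : SignVec N, convMajorant A (signs x) (signs y) :=
      Finset.sum_nonneg fun x _ => Finset.sum_nonneg fun y _ =>
        convMajorant_nonneg (isSign_signs x) (isSign_signs y) A
    simp only [one_mul] at h3
    rw [h3]
    rw [pow_succ] at h2 ⊢
    linarith

theorem sum_sum_convMajorant_le {N A : ℕ} (hA : A + 1 ≤ N) :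
    ∑ x : SignVec N, ∑ y : SignVec N, convMajorant (A + 1) (signs x) (signs y)
      ≤ 180 * 2 ^ A * 4 ^ N := by
  have h1 := sum_sum_convMajorant_pair_le hA
  have h4 : (0 : ℝ) ≤ ∑ x : SignVec N, ∑ y : SignVec N, convMajorant A (signs x) (signs y) :=
    Finset.sum_nonneg fun x _ => Finset.sum_nonneg fun y _ =>
      convMajorant_nonneg (isSign_signs x) (isSign_signs y) A
  linarith

/-- The step factor is again 1.8; enlarging it to 1.9 leaves room to absorb the source term, which
is linear in `i`. -/
theorem sum_sum_farPair_mul_convMajorant_pair_le {N k i : ℕ} (h : k + i + 1 ≤ N) :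
    ∑ x : SignVec N, ∑ y : SignVec N,
        farPair k (signs x) (signs y) * convMajorant (k + i + 1) (signs x) (signs y)
      + 3 / 10 * ∑ x : SignVec N, ∑ y : SignVec N,
        farPair k (signs x) (signs y) * convMajorant (k + i) (signs x) (signs y)
      ≤ 304 * (19 / 10) ^ i * 2 ^ k * 4 ^ N := by
  have p : (0 : ℝ) < 2 ^ k * 4 ^ N := by positivity
  have drop : ∀ B, ∑ x : SignVec N, ∑ y : SignVec N,
        farPair k (signs x) (signs y) * convMajorant B (signs x) (signs y)
      ≤ ∑ x : SignVec N, ∑ y : SignVec N, convMajorant B (signs x) (signs y) := fun B =>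
    Finset.sum_le_sum fun x _ => Finset.sum_le_sum fun y _ =>
      mul_le_of_le_one_left (convMajorant_nonneg (isSign_signs x) (isSign_signs y) B)
        (farPair_le_one _ _ _)
  induction i with
  | zero =>
    have h1 := sum_sum_convMajorant_pair_le (N := N) (A := k) (by omega)
    have h2 := drop (k + 1)
    have h3 := drop k
    rw [add_zero, pow_zero]
    linarith
  | succ i ih =>
    have h1 := ih (by omega)
    have h2 := sum_sum_farPair_mul_splitPart_le (N := N) (k := k) (i := i + 1) (by omega)
    have h3 := sum_sum_mul_convMajorant_add_two (N := N) (A := k + i) (by omega) (farPair k)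
      fun ε ε' δ e => farPair_congr_left (by omega) δ e
    have h4 : (0 : ℝ) ≤ ∑ x : SignVec N, ∑ y : SignVec N,
        farPair k (signs x) (signs y) * convMajorant (k + i) (signs x) (signs y) :=
      Finset.sum_nonneg fun x _ => Finset.sum_nonneg fun y _ => mul_nonneg (farPair_nonneg _ _ _)
        (convMajorant_nonneg (isSign_signs x) (isSign_signs y) _)
    -- The slack is `(1.9 - 1.8) · 304 · 1.9^i`; Bernoulli's inequality shows that it dominates the
    -- source.
    have b : 8 * ((i + 1 : ℕ) + 2 : ℝ) ≤ 304 / 10 * (19 / 10) ^ i := by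
      have := one_add_mul_le_pow (a := (9 / 10 : ℝ)) (by norm_num) i
      norm_num at this ⊢
      have : (0 : ℝ) ≤ i := i.cast_nonneg
      linarith
    have b' := mul_le_mul_of_nonneg_right b p.le
    rw [show k + (i + 1) + 1 = k + i + 2 by ring, h3]
    rw [← add_assoc] at h2 ⊢
    rw [pow_succ]
    linarith

theorem sum_sum_farPair_mul_convMajorant_le {N k i : ℕ} (h : k + i + 1 ≤ N) :
    ∑ x : SignVec N, ∑ y : SignVec N,
        farPair k (signs x) (signs y) * convMajorant (k + i + 1) (signs x) (signs y)
      ≤ 304 * (19 / 10) ^ i * 2 ^ k * 4 ^ N := by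
  have h1 := sum_sum_farPair_mul_convMajorant_pair_le h
  have h4 : (0 : ℝ) ≤ ∑ x : SignVec N, ∑ y : SignVec N,
      farPair k (signs x) (signs y) * convMajorant (k + i) (signs x) (signs y) :=
    Finset.sum_nonneg fun x _ => Finset.sum_nonneg fun y _ => mul_nonneg (farPair_nonneg _ _ _)
      (convMajorant_nonneg (isSign_signs x) (isSign_signs y) _)
  linarith

/-! ### Calderón–Zygmund decomposition on a finite set with nested partitions -/

/-- A decreasing sequence of equivalence relations on a finite set, from the trivial one to
equality, such that a class of level `k` has `4 ^ (N - k)` elements. -/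
structure IsDyadicGrid {X : Type*} [Fintype X] (N : ℕ) (r : ℕ → X → X → Prop) : Prop where
  equiv : ∀ k, Equivalence (r k)
  anti : ∀ {j k x y}, j ≤ k → r k x y → r j x y
  zero : ∀ x y, r 0 x y
  eq_of_top : ∀ {x y}, r N x y → x = y
  card : ∀ {k}, k ≤ N → ∀ x, (Nat.card {y // r k x y} : ℝ) * 4 ^ k = 4 ^ N

/-- A set of points with a level at each of them, such that the classes at these levels partition
the set. -/
structure IsStopping {X : Type*} (N : ℕ) (r : ℕ → X → X → Prop) (bad : Set X) (τ : X → ℕ) :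
    Prop where
  level_le : ∀ {x}, x ∈ bad → τ x ≤ N
  mem : ∀ {x y}, x ∈ bad → r (τ x) x y → y ∈ bad
  level_eq : ∀ {x y}, x ∈ bad → r (τ x) x y → τ y = τ x

section

open Classical

variable {X E : Type*} [Fintype X] [NormedAddCommGroup E] {N : ℕ}
  {r : ℕ → X → X → Prop} {bad : Set X} {τ : X → ℕ}

/-- The mean of `|F|` over the class of `x` of level `k`, for the density `4 ^ N • F`. -/
def classMean (r : ℕ → X → X → Prop) (F : X → E) (k : ℕ) (x : X) : ℝ :=
  4 ^ k * ∑ y with r k x y, ‖F y‖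

theorem IsDyadicGrid.card_filter (hr : IsDyadicGrid N r) {k : ℕ} (hk : k ≤ N) (x : X) :
    ((Finset.univ.filter (r k x)).card : ℝ) * 4 ^ k = 4 ^ N := by
  rw [← hr.card hk x, Nat.card_eq_fintype_card, Fintype.card_subtype]

theorem IsDyadicGrid.filter_eq (hr : IsDyadicGrid N r) {k : ℕ} {x y : X} (h : r k x y) :
    Finset.univ.filter (r k x) = Finset.univ.filter (r k y) := by
  ext z
  simp only [Finset.mem_filter, Finset.mem_univ, true_and]
  exact ⟨fun h' => (hr.equiv k).trans ((hr.equiv k).symm h) h', fun h' => (hr.equiv k).trans h h'⟩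

theorem classMean_congr (hr : IsDyadicGrid N r) (F : X → E) {j k : ℕ} (hjk : j ≤ k) {x y : X}
    (h : r k x y) : classMean r F j x = classMean r F j y := by
  unfold classMean
  rw [hr.filter_eq (hr.anti hjk h)]

theorem classMean_zero (hr : IsDyadicGrid N r) (F : X → E) (x : X) :
    classMean r F 0 x = ∑ y, ‖F y‖ := by
  simp [classMean, hr.zero]

theorem classMean_top (hr : IsDyadicGrid N r) (F : X → E) (x : X) :
    classMean r F N x = 4 ^ N * ‖F x‖ := by
  have : Finset.univ.filter (r N x) = {x} := by
    ext y
    simp only [Finset.mem_filter, Finset.mem_univ, true_and, Finset.mem_singleton]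
    exact ⟨fun h => (hr.eq_of_top h).symm, fun h => h ▸ (hr.equiv N).refl _⟩
  simp [classMean, this]

theorem classMean_succ_le (hr : IsDyadicGrid N r) (F : X → E) (k : ℕ) (x : X) :
    classMean r F (k + 1) x ≤ 4 * classMean r F k x := by
  have : ∑ y with r (k + 1) x y, ‖F y‖ ≤ ∑ y with r k x y, ‖F y‖ :=
    Finset.sum_le_sum_of_subset_of_nonneg
      (Finset.monotone_filter_right _ fun y _ h => hr.anti k.le_succ h)
      fun _ _ _ => norm_nonneg _
  unfold classMean
  have := mul_le_mul_of_nonneg_left this (show (0 : ℝ) ≤ 4 ^ (k + 1) by positivity)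
  rw [pow_succ] at *
  linarith

/-- Stop at the first level at which the mean exceeds `a`. The mean one level above was at most `a`,
and passing to a subclass multiplies a mean by at most 4; level 0 cannot be selected because of
`ha`. -/
theorem exists_isStopping (hr : IsDyadicGrid N r) (F : X → E) {a : ℝ}
    (ha : ∑ y, ‖F y‖ ≤ a) :
    ∃ (bad : Set X) (τ : X → ℕ), IsStopping N r bad τ ∧
      (∀ x ∈ bad, a < classMean r F (τ x) x ∧ classMean r F (τ x) x ≤ 4 * a) ∧
      ∀ x ∉ bad, 4 ^ N * ‖F x‖ ≤ a := by
  let bad : Set X := {x | ∃ k, k ≤ N ∧ a < classMean r F k x}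
  have hex : ∀ x, x ∈ bad → ∃ k, (k ≤ N ∧ a < classMean r F k x) ∧
      ∀ j < k, classMean r F j x ≤ a := by
    intro x hx
    refine ⟨Nat.find hx, Nat.find_spec hx, fun j hj => ?_⟩
    have h1 := Nat.find_min hx hj
    have h2 := (Nat.find_spec hx).1
    by_contra! h3
    exact h1 ⟨by omega, h3⟩
  choose! τ hτ using hex
  have hmem : ∀ {x y}, x ∈ bad → r (τ x) x y → y ∈ bad := fun {x y} hx hxy =>
    ⟨τ x, (hτ x hx).1.1, by rw [← classMean_congr hr F le_rfl hxy]; exact (hτ x hx).1.2⟩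
  refine ⟨bad, τ, ⟨fun hx => (hτ _ hx).1.1, hmem, ?_⟩, ?_, ?_⟩
  · intro x y hx hxy
    have hy := hmem hx hxy
    rcases lt_trichotomy (τ y) (τ x) with h | h | h
    · have h1 := (hτ x hx).2 _ h
      rw [classMean_congr hr F h.le hxy] at h1
      exact absurd (hτ y hy).1.2 h1.not_gt
    · exact h
    · have h1 := (hτ y hy).2 _ h
      rw [← classMean_congr hr F le_rfl hxy] at h1
      exact absurd (hτ x hx).1.2 h1.not_gt
  · intro x hx
    refine ⟨(hτ x hx).1.2, ?_⟩
    rcases hk : τ x with _ | k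
    · have := (hτ x hx).1.2
      rw [hk, classMean_zero hr] at this
      linarith
    · have h1 := (hτ x hx).2 k (by omega)
      have h2 := classMean_succ_le hr F k x
      linarith
  · intro x hx
    rw [← classMean_top hr F x]
    by_contra! h
    exact hx ⟨N, le_rfl, h⟩

variable [NormedSpace ℝ E]

/-- `F` replaced on each stopped class by its mean over the class. -/
def stoppedMean (N : ℕ) (r : ℕ → X → X → Prop) (bad : Set X) (τ : X → ℕ) (F : X → E) (x : X) : E :=
  if x ∈ bad then ((4 : ℝ) ^ τ x / 4 ^ N) • ∑ y with r (τ x) x y, F y else F x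

/-- The weight `4^τ / 4^N` is the reciprocal of the number of points in the stopped class, so after
exchanging the sums each point of `bad` is counted with total weight `c`. -/
theorem IsStopping.sum_smul_sum (hr : IsDyadicGrid N r) (hs : IsStopping N r bad τ) (φ : X → E)
    (c : X → ℝ) (hc : ∀ x ∈ bad, ∀ y, r (τ x) x y → c y = c x) :
    ∑ x with x ∈ bad, (c x * 4 ^ τ x / 4 ^ N) • ∑ y with r (τ x) x y, φ y
      = ∑ y with y ∈ bad, c y • φ y := by
  simp_rw [Finset.smul_sum]
  rw [Finset.sum_comm' (t' := Finset.univ.filter (· ∈ bad))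
    (s' := fun y => Finset.univ.filter (r (τ y) y))]
  · refine Finset.sum_congr rfl fun y hy => ?_
    have hy' : y ∈ bad := by simpa using hy
    rw [← Finset.sum_smul]
    congr 1
    have : ∀ x ∈ Finset.univ.filter (r (τ y) y), c x * 4 ^ τ x / 4 ^ N = c y * 4 ^ τ y / 4 ^ N := by
      intro x hx
      have hx' : r (τ y) y x := by simpa using hx
      rw [hc y hy' x hx', hs.level_eq hy' hx']
    rw [Finset.sum_congr rfl this, Finset.sum_const, nsmul_eq_mul]
    have h1 := hr.card_filter (hs.level_le hy') y
    have h2 : (4 : ℝ) ^ N ≠ 0 := by positivity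
    field_simp
    rw [← h1]; ring
  · intro x y
    simp only [Finset.mem_filter, Finset.mem_univ, true_and]
    constructor
    · rintro ⟨hx, hxy⟩
      refine ⟨?_, hs.mem hx hxy⟩
      rw [hs.level_eq hx hxy]
      exact (hr.equiv _).symm hxy
    · rintro ⟨hyx, hy⟩
      refine ⟨hs.mem hy hyx, ?_⟩
      rw [hs.level_eq hy hyx]
      exact (hr.equiv _).symm hyx

theorem IsStopping.sum_smul_stoppedMean (hr : IsDyadicGrid N r) (hs : IsStopping N r bad τ)
    (F : X → E) (c : X → ℝ) (hc : ∀ x ∈ bad, ∀ y, r (τ x) x y → c y = c x) :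
    ∑ x with x ∈ bad, c x • stoppedMean N r bad τ F x = ∑ x with x ∈ bad, c x • F x := by
  rw [← hs.sum_smul_sum hr F c hc]
  refine Finset.sum_congr rfl fun x hx => ?_
  have hx' : x ∈ bad := by simpa using hx
  rw [stoppedMean, if_pos hx', smul_smul, mul_div_assoc]

theorem norm_stoppedMean_le {x : X} (hx : x ∈ bad) (F : X → E) :
    ‖stoppedMean N r bad τ F x‖ ≤ 4 ^ τ x / 4 ^ N * ∑ y with r (τ x) x y, ‖F y‖ := by
  rw [stoppedMean, if_pos hx, norm_smul, Real.norm_of_nonneg (by positivity)]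
  exact mul_le_mul_of_nonneg_left (norm_sum_le _ _) (by positivity)

theorem IsStopping.sum_norm_stoppedMean_le (hr : IsDyadicGrid N r) (hs : IsStopping N r bad τ)
    (F : X → E) :
    ∑ x with x ∈ bad, ‖stoppedMean N r bad τ F x‖ ≤ ∑ x with x ∈ bad, ‖F x‖ := by
  have h := hs.sum_smul_sum hr (fun y => ‖F y‖) (fun _ => 1) fun _ _ _ _ => rfl
  simp only [one_mul, smul_eq_mul] at h
  rw [← h]
  exact Finset.sum_le_sum fun x hx => norm_stoppedMean_le (by simpa using hx) F

/-- The weak type estimate for the maximal operator of a family of kernels on a dyadic grid. -/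
theorem IsDyadicGrid.weak_type (hr : IsDyadicGrid N r) {ι : Type*} (level : ι → ℕ)
    (hlevel : ∀ n, level n < N) (K : ι → X → X → ℝ) (G : ℕ → X → X → ℝ)
    (hG : ∀ A x y, 0 ≤ G A x y) (hKG : ∀ n x y, |K n x y| ≤ G (level n) x y)
    (hK : ∀ n x y y', r (level n + 1) y y' → K n x y' = K n x y)
    {C₁ C₂ : ℝ} (hC₁ : 0 ≤ C₁) (hC₂ : 0 ≤ C₂)
    (hbdd : ∀ n x, ∑ y, |K n x y| ≤ C₁ * 4 ^ N)
    (hfar : ∀ k ≤ N, ∀ y, ∑ A ∈ Finset.Ico k N, ∑ x with ¬ r k x y, G A x y ≤ C₂ * 4 ^ N)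
    (F : X → E) {t : ℝ} (ht : 0 < t) :
    ((Finset.univ.filter fun x => ∃ n, t < ‖∑ y, K n x y • F y‖).card : ℝ) * t
      ≤ (4 * C₁ + 1) * (1 + 2 * C₂) * 4 ^ N * ∑ y, ‖F y‖ := by
  set S := Finset.univ.filter fun x => ∃ n, t < ‖∑ y, K n x y • F y‖ with hS
  -- The good part will contribute at most `4 * C₁ * a`, which leaves `a` for the bad part.
  set a : ℝ := t / (4 * C₁ + 1) with ha
  have hC : 0 < 4 * C₁ + 1 := by linarith
  have hta : t = (4 * C₁ + 1) * a := by rw [ha]; field_simp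
  have ha0 : 0 < a := by positivity
  have hFnn : 0 ≤ ∑ y, ‖F y‖ := Finset.sum_nonneg fun _ _ => norm_nonneg _
  have h4 : (0 : ℝ) < 4 ^ N := by positivity
  suffices h : (S.card : ℝ) * a ≤ (1 + 2 * C₂) * 4 ^ N * ∑ y, ‖F y‖ by
    rw [hta]
    have := mul_le_mul_of_nonneg_left h hC.le
    linarith
  -- If the mean over the whole space exceeds `a`, counting all `4 ^ N` points is already enough.
  rcases lt_or_ge a (∑ y, ‖F y‖) with hlt | hge
  · have hcard : (S.card : ℝ) ≤ 4 ^ N := by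
      rcases S.eq_empty_or_nonempty with e | ⟨x, _⟩
      · rw [e]; simp
      · rw [← hr.card_filter (Nat.zero_le N) x, pow_zero, mul_one]
        exact_mod_cast Finset.card_le_card fun y _ => by simp [hr.zero]
    have h1 : (S.card : ℝ) * a ≤ 4 ^ N * ∑ y, ‖F y‖ :=
      mul_le_mul hcard hlt.le ha0.le h4.le
    have h2 : 0 ≤ 2 * C₂ * (4 ^ N * ∑ y, ‖F y‖) := by positivity
    linarith
  obtain ⟨bad, τ, hs, hbad, hgood⟩ := exists_isStopping hr F hge
  set g := stoppedMean N r bad τ F with hg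
  have hgF : ∀ x, x ∉ bad → g x = F x := fun x hx => by rw [hg, stoppedMean, if_neg hx]
  have hgle : ∀ x, ‖g x‖ ≤ 4 * a / 4 ^ N := by
    intro x
    rw [le_div_iff₀ h4]
    by_cases hx : x ∈ bad
    · have h1 := norm_stoppedMean_le (N := N) (r := r) (τ := τ) hx F
      have h2 := (hbad x hx).2
      rw [classMean] at h2
      rw [div_mul_eq_mul_div, le_div_iff₀ h4] at h1
      exact h1.trans h2
    · rw [hgF x hx]
      linarith [hgood x hx]
  have hcardbad : ((Finset.univ.filter (· ∈ bad)).card : ℝ) * a ≤ 4 ^ N * ∑ y, ‖F y‖ := by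
    have h := hs.sum_smul_sum hr (fun y => ‖F y‖) (fun _ => (4 : ℝ) ^ N) fun _ _ _ _ => rfl
    simp only [smul_eq_mul, ← Finset.mul_sum] at h
    calc ((Finset.univ.filter (· ∈ bad)).card : ℝ) * a
        = ∑ x with x ∈ bad, a := by rw [Finset.sum_const, nsmul_eq_mul]
      _ ≤ ∑ x with x ∈ bad, 4 ^ N * 4 ^ τ x / 4 ^ N * ∑ y with r (τ x) x y, ‖F y‖ := by
          refine Finset.sum_le_sum fun x hx => ?_
          rw [mul_div_cancel_left₀ _ h4.ne']
          exact (hbad x (by simpa using hx)).1.le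
      _ = 4 ^ N * ∑ x with x ∈ bad, ‖F x‖ := h
      _ ≤ 4 ^ N * ∑ y, ‖F y‖ := by
          refine mul_le_mul_of_nonneg_left ?_ h4.le
          exact Finset.sum_le_sum_of_subset_of_nonneg (Finset.filter_subset _ _)
            fun _ _ _ => norm_nonneg _
  -- Summing over all levels from `τ y` on makes `B` independent of `n`, so it controls the supremum
  -- over the kernels.
  set B : X → ℝ := fun x => ∑ y with y ∈ bad, ∑ A ∈ Finset.Ico (τ y) N, G A x y * ‖F y - g y‖
    with hB
  have hmain : ∀ n x, ‖∑ y, K n x y • F y‖ ≤ 4 * C₁ * a + B x := by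
    intro n x
    have split : ∑ y, K n x y • F y = ∑ y, K n x y • g y
        + ∑ y with y ∈ bad, (if τ y ≤ level n then K n x y else 0) • (F y - g y) := by
      have h1 : ∑ y, K n x y • (F y - g y) = ∑ y with y ∈ bad, K n x y • (F y - g y) := by
        rw [Finset.sum_filter]
        refine Finset.sum_congr rfl fun y _ => ?_
        split_ifs with hy
        · rfl
        · rw [hgF y hy, sub_self, smul_zero]
      -- A class stopped after `level n` lies in a class of level `level n + 1`, where the kernel is
      -- constant in `y`; `F - g` has sum zero on it.
      have h2 : ∑ y with y ∈ bad, (if τ y ≤ level n then 0 else K n x y) • (F y - g y) = 0 := by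
        simp_rw [smul_sub, Finset.sum_sub_distrib]
        rw [hs.sum_smul_stoppedMean hr, sub_self]
        intro y hy y' hyy'
        rw [hs.level_eq hy hyy']
        split_ifs with hl
        · rfl
        · exact hK n x y y' (hr.anti (by omega) hyy')
      have h3 : ∑ y, K n x y • F y = ∑ y, K n x y • g y + ∑ y, K n x y • (F y - g y) := by
        simp_rw [smul_sub, Finset.sum_sub_distrib]; abel
      rw [h3, h1, ← add_zero (∑ y with y ∈ bad, (if τ y ≤ level n then K n x y else 0) • _), ← h2,
        ← Finset.sum_add_distrib]
      congr 1
      refine Finset.sum_congr rfl fun y _ => ?_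
      split_ifs <;> simp
    rw [split]
    refine (norm_add_le _ _).trans (add_le_add ?_ ?_)
    · calc ‖∑ y, K n x y • g y‖ ≤ ∑ y, |K n x y| * (4 * a / 4 ^ N) := by
            refine norm_sum_le_of_le _ fun y _ => ?_
            rw [norm_smul, Real.norm_eq_abs]
            exact mul_le_mul_of_nonneg_left (hgle y) (abs_nonneg _)
        _ ≤ C₁ * 4 ^ N * (4 * a / 4 ^ N) := by
            rw [← Finset.sum_mul]
            exact mul_le_mul_of_nonneg_right (hbdd n x) (by positivity)
        _ = 4 * C₁ * a := by field_simp
    · refine norm_sum_le_of_le _ fun y _ => ?_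
      have hnn : ∀ A ∈ Finset.Ico (τ y) N, 0 ≤ G A x y * ‖F y - g y‖ := fun A _ =>
        mul_nonneg (hG A x y) (norm_nonneg _)
      split_ifs with hl
      · rw [norm_smul, Real.norm_eq_abs]
        refine (mul_le_mul_of_nonneg_right (hKG n x y) (norm_nonneg _)).trans ?_
        exact Finset.single_le_sum (f := fun A => G A x y * ‖F y - g y‖) hnn
          (Finset.mem_Ico.2 ⟨hl, hlevel n⟩)
      · rw [zero_smul, norm_zero]
        exact Finset.sum_nonneg hnn
  have hBnn : ∀ x, 0 ≤ B x := fun x => Finset.sum_nonneg fun y _ => Finset.sum_nonneg fun A _ =>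
    mul_nonneg (hG A x y) (norm_nonneg _)
  have hBsum : ∑ x with x ∉ bad, B x ≤ 2 * C₂ * 4 ^ N * ∑ y, ‖F y‖ := by
    have hb : ∑ y with y ∈ bad, ‖F y - g y‖ ≤ 2 * ∑ y, ‖F y‖ := by
      have h1 : ∑ y with y ∈ bad, ‖F y‖ ≤ ∑ y, ‖F y‖ :=
        Finset.sum_le_sum_of_subset_of_nonneg (Finset.filter_subset _ _)
          fun _ _ _ => norm_nonneg _
      have h2 : ∑ y with y ∈ bad, ‖F y - g y‖
          ≤ ∑ y with y ∈ bad, ‖F y‖ + ∑ y with y ∈ bad, ‖g y‖ := by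
        rw [← Finset.sum_add_distrib]
        exact Finset.sum_le_sum fun y _ => norm_sub_le _ _
      linarith [hs.sum_norm_stoppedMean_le hr F]
    calc ∑ x with x ∉ bad, B x
        = ∑ y with y ∈ bad,
            (∑ A ∈ Finset.Ico (τ y) N, ∑ x with x ∉ bad, G A x y) * ‖F y - g y‖ := by
          simp only [hB]
          rw [Finset.sum_comm]
          refine Finset.sum_congr rfl fun y _ => ?_
          rw [Finset.sum_comm, Finset.sum_mul]
          exact Finset.sum_congr rfl fun A _ => by rw [Finset.sum_mul]
      _ ≤ ∑ y with y ∈ bad, C₂ * 4 ^ N * ‖F y - g y‖ := by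
          refine Finset.sum_le_sum fun y hy => mul_le_mul_of_nonneg_right ?_ (norm_nonneg _)
          have hy' : y ∈ bad := by simpa using hy
          refine le_trans (Finset.sum_le_sum fun A _ => ?_) (hfar (τ y) (hs.level_le hy') y)
          refine Finset.sum_le_sum_of_subset_of_nonneg ?_ fun x _ _ => hG A x y
          -- A point outside `bad` lies outside the stopped class of `y`, so the off-class bound
          -- `hfar` applies.
          refine Finset.monotone_filter_right _ fun x _ hx hxy => hx ?_
          exact hs.mem hy' ((hr.equiv _).symm hxy)
      _ = C₂ * 4 ^ N * ∑ y with y ∈ bad, ‖F y - g y‖ := by rw [Finset.mul_sum]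
      _ ≤ C₂ * 4 ^ N * (2 * ∑ y, ‖F y‖) := mul_le_mul_of_nonneg_left hb (by positivity)
      _ = 2 * C₂ * 4 ^ N * ∑ y, ‖F y‖ := by ring
  have hsub : S ⊆ Finset.univ.filter (· ∈ bad)
      ∪ Finset.univ.filter (fun x => x ∉ bad ∧ a ≤ B x) := by
    intro x hx
    simp only [hS, Finset.mem_filter, Finset.mem_univ, true_and] at hx
    obtain ⟨n, hn⟩ := hx
    simp only [Finset.mem_union, Finset.mem_filter, Finset.mem_univ, true_and]
    by_cases hxb : x ∈ bad
    · exact Or.inl hxb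
    · refine Or.inr ⟨hxb, ?_⟩
      have := hmain n x
      rw [hta] at hn
      linarith
  have hcardB : ((Finset.univ.filter (fun x => x ∉ bad ∧ a ≤ B x)).card : ℝ) * a
      ≤ ∑ x with x ∉ bad, B x := by
    rw [← nsmul_eq_mul, ← Finset.sum_const]
    refine (Finset.sum_le_sum (g := B) fun x hx => ?_).trans
      (Finset.sum_le_sum_of_subset_of_nonneg ?_ fun x _ _ => hBnn x)
    · exact (by simpa using hx : x ∉ bad ∧ a ≤ B x).2
    · exact Finset.monotone_filter_right _ fun x _ hx => hx.1
  have hcardS : (S.card : ℝ) ≤ (Finset.univ.filter (· ∈ bad)).card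
      + (Finset.univ.filter (fun x => x ∉ bad ∧ a ≤ B x)).card := by
    exact_mod_cast (Finset.card_le_card hsub).trans (Finset.card_union_le _ _)
  have := mul_le_mul_of_nonneg_right hcardS ha0.le
  linarith

end

/-! ### The triangular Fejér kernels on the grid of dyadic squares -/

/-- Two dyadic squares of level `N` lie in the same dyadic square of level `k`. -/
def sameSquare {N : ℕ} (k : ℕ) (p q : SignVec N × SignVec N) : Prop :=
  ∀ j < k, signs p.1 j = signs q.1 j ∧ signs p.2 j = signs q.2 j

/-- The triangular Fejér kernel on the grid of dyadic squares. -/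
def fejerKernel {N : ℕ} (n : ℕ) (p q : SignVec N × SignVec N) : ℝ :=
  dirichletConv n (signs (p.1 * q.1)) (signs (p.2 * q.2)) / n

/-- A majorant of `|fejerKernel n|` over all `2 ^ A ≤ n < 2 ^ (A + 1)`. -/
def fejerMajorant {N : ℕ} (A : ℕ) (p q : SignVec N × SignVec N) : ℝ :=
  convMajorant (A + 1) (signs (p.1 * q.1)) (signs (p.2 * q.2)) / 2 ^ A

theorem signs_mul_eq_one_iff {N : ℕ} (x y : SignVec N) (j : ℕ) :
    signs (x * y) j = 1 ↔ signs x j = signs y j := by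
  rw [signs_mul]
  rcases isSign_signs x j with h | h <;> rcases isSign_signs y j with h' | h' <;>
    simp only [h, h'] <;> norm_num

open Classical in
theorem dirichlet_two_pow_eq_ite {ε : ℕ → ℝ} (hε : IsSign ε) (A : ℕ) :
    dirichlet (2 ^ A) ε = if ∀ j < A, ε j = 1 then 2 ^ A else 0 := by
  split_ifs with h
  · induction A with
    | zero => simp
    | succ A ih =>
      rw [dirichlet_two_pow_succ, ih fun j hj => h j (by omega), h A (by omega)]; ring
  · push Not at h
    obtain ⟨j, hj, hj'⟩ := h
    exact dirichlet_two_pow_eq_zero hε hj hj'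

theorem sum_translate {N : ℕ} (h : SignVec N → SignVec N → ℝ) (p : SignVec N × SignVec N) :
    ∑ q : SignVec N × SignVec N, h (p.1 * q.1) (p.2 * q.2)
      = ∑ x : SignVec N, ∑ y : SignVec N, h x y := by
  rw [← Fintype.sum_prod_type']
  exact Equiv.sum_comp (Equiv.mulLeft p) fun q : SignVec N × SignVec N => h q.1 q.2

open Classical in
theorem isDyadicGrid_sameSquare (N : ℕ) :
    IsDyadicGrid N (sameSquare (N := N)) where
  equiv k := ⟨fun p j _ => ⟨rfl, rfl⟩, fun h j hj => ⟨(h j hj).1.symm, (h j hj).2.symm⟩,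
    fun h h' j hj => ⟨(h j hj).1.trans (h' j hj).1, (h j hj).2.trans (h' j hj).2⟩⟩
  anti hjk h i hi := h i (by omega)
  zero x y j hj := by omega
  eq_of_top {x y} h := by
    have inj : ∀ {u v : SignVec N}, (∀ j < N, signs u j = signs v j) → u = v := by
      intro u v huv
      funext ⟨j, hj⟩
      have := huv j hj
      simp only [signs, hj, dif_pos] at this
      exact Units.ext (by exact_mod_cast this)
    exact Prod.ext (inj fun j hj => (h j hj).1) (inj fun j hj => (h j hj).2)
  card {k} hk p := by
    -- The product of two kernels `D_{2^k}` is `4^k` times the indicator of the square of level `k`,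
    -- so its sum counts the class.
    have h := sum_translate (fun x y : SignVec N =>
      dirichlet (2 ^ k) (signs x) * dirichlet (2 ^ k) (signs y)) p
    rw [← Finset.sum_mul_sum, sum_dirichlet_two_pow hk, ← mul_pow] at h
    have e : ∀ q : SignVec N × SignVec N,
        dirichlet (2 ^ k) (signs (p.1 * q.1)) * dirichlet (2 ^ k) (signs (p.2 * q.2))
          = if sameSquare k p q then 4 ^ k else 0 := by
      intro q
      rw [dirichlet_two_pow_eq_ite (isSign_signs _), dirichlet_two_pow_eq_ite (isSign_signs _),
        ite_zero_mul_ite_zero, ← mul_pow]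
      refine if_congr ?_ (by norm_num) rfl
      simp only [signs_mul_eq_one_iff]
      exact ⟨fun h j hj => ⟨h.1 j hj, h.2 j hj⟩,
        fun h => ⟨fun j hj => (h j hj).1, fun j hj => (h j hj).2⟩⟩
    simp only [e] at h
    rw [← Finset.sum_filter, Finset.sum_const, nsmul_eq_mul] at h
    rw [Nat.card_eq_fintype_card, Fintype.card_subtype, h]
    norm_num

theorem fejerMajorant_nonneg {N : ℕ} (A : ℕ) (p q : SignVec N × SignVec N) :
    0 ≤ fejerMajorant A p q :=
  div_nonneg (convMajorant_nonneg (isSign_signs _) (isSign_signs _) _) (by positivity)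

theorem abs_fejerKernel_le {N A n : ℕ} (h : 2 ^ A ≤ n) (h' : n < 2 ^ (A + 1))
    (p q : SignVec N × SignVec N) : |fejerKernel n p q| ≤ fejerMajorant A p q := by
  rw [fejerKernel, abs_div, Nat.abs_cast]
  have : (2 ^ A : ℝ) ≤ n := by exact_mod_cast h
  exact div_le_div₀ (convMajorant_nonneg (isSign_signs _) (isSign_signs _) _)
    (abs_dirichletConv_le (isSign_signs _) (isSign_signs _) h'.le) (by positivity) this

theorem fejerKernel_congr {N A n : ℕ} (h : n < 2 ^ A) (p : SignVec N × SignVec N)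
    {q q' : SignVec N × SignVec N} (hq : sameSquare A q q') :
    fejerKernel n p q' = fejerKernel n p q := by
  unfold fejerKernel
  congr 1
  exact dirichletConv_congr h.le (fun k hk => by simp only [signs_mul, (hq k hk).1])
    (fun k hk => by simp only [signs_mul, (hq k hk).2])

theorem sum_abs_fejerKernel_le {N n : ℕ} (hn : 1 ≤ n) (hn' : n < 2 ^ N)
    (p : SignVec N × SignVec N) : ∑ q, |fejerKernel n p q| ≤ 180 * 4 ^ N := by
  have hA : Nat.log 2 n < N := Nat.log_lt_of_lt_pow (by omega) hn'
  refine (Finset.sum_le_sum fun q _ => abs_fejerKernel_le (Nat.pow_log_le_self 2 (by omega))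
    (Nat.lt_pow_succ_log_self (by norm_num) n) p q).trans ?_
  simp only [fejerMajorant]
  rw [← Finset.sum_div, sum_translate (fun x y => convMajorant _ (signs x) (signs y)),
    div_le_iff₀ (by positivity)]
  have := sum_sum_convMajorant_le (N := N) (A := Nat.log 2 n) hA
  linarith

-- Translation by `q` moves the complement of the square of `q` to the far set at the origin;
-- division by `2^(k+i)` turns the growth rate 19/10 into the decay rate 19/20.
open Classical in
theorem sum_fejerMajorant_not_sameSquare_le {N k i : ℕ} (h : k + i + 1 ≤ N)
    (q : SignVec N × SignVec N) :
    ∑ p with ¬ sameSquare k p q, fejerMajorant (k + i) p q ≤ 304 * (19 / 20) ^ i * 4 ^ N := by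
  have e : ∀ p : SignVec N × SignVec N,
      (if ¬ sameSquare k p q then fejerMajorant (k + i) p q else 0)
      = farPair k (signs (q.1 * p.1)) (signs (q.2 * p.2))
          * convMajorant (k + i + 1) (signs (q.1 * p.1)) (signs (q.2 * p.2)) / 2 ^ (k + i) := by
    intro p
    have : sameSquare k p q ↔ ((∀ j < k, signs (q.1 * p.1) j = 1)
        ∧ ∀ j < k, signs (q.2 * p.2) j = 1) := by
      simp only [signs_mul_eq_one_iff]
      exact ⟨fun h => ⟨fun j hj => (h j hj).1.symm, fun j hj => (h j hj).2.symm⟩,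
        fun h j hj => ⟨(h.1 j hj).symm, (h.2 j hj).symm⟩⟩
    unfold farPair
    rw [fejerMajorant, mul_comm p.1, mul_comm p.2]
    by_cases hs : sameSquare k p q
    · rw [if_neg (not_not.2 hs), if_pos (this.1 hs)]; ring
    · rw [if_pos hs, if_neg (mt this.2 hs)]; ring
  rw [Finset.sum_filter, Finset.sum_congr rfl fun p _ => e p, ← Finset.sum_div,
    sum_translate (fun x y => farPair k (signs x) (signs y)
      * convMajorant (k + i + 1) (signs x) (signs y)), div_le_iff₀ (by positivity)]
  refine (sum_sum_farPair_mul_convMajorant_le h).trans (le_of_eq ?_)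
  rw [show (19 / 10 : ℝ) = 19 / 20 * 2 by norm_num, mul_pow, pow_add]
  ring

open Classical in
theorem sum_sum_fejerMajorant_not_sameSquare_le {N k : ℕ} (q : SignVec N × SignVec N) :
    ∑ A ∈ Finset.Ico k N, ∑ p with ¬ sameSquare k p q, fejerMajorant A p q ≤ 6080 * 4 ^ N := by
  rw [Finset.sum_Ico_eq_sum_range]
  calc _ ≤ ∑ i ∈ Finset.range (N - k), 304 * (19 / 20 : ℝ) ^ i * 4 ^ N :=
        Finset.sum_le_sum fun i hi => by
          have := Finset.mem_range.1 hi
          exact sum_fejerMajorant_not_sameSquare_le (by omega) q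
    _ = 304 * 4 ^ N * ∑ i ∈ Finset.range (N - k), (19 / 20 : ℝ) ^ i := by
        rw [Finset.mul_sum]; exact Finset.sum_congr rfl fun i _ => by ring
    -- The geometric series with ratio 19/20 has sum 20.
    _ ≤ 304 * 4 ^ N * 20 := by
        refine mul_le_mul_of_nonneg_left ?_ (by positivity)
        have h1 := mul_neg_geom_sum (19 / 20 : ℝ) (N - k)
        have h2 : (0 : ℝ) < (19 / 20) ^ (N - k) := by positivity
        linarith
    _ = 6080 * 4 ^ N := by ring

open Classical in
theorem exists_grid_weak_type : ∃ C : ℝ, 0 ≤ C ∧ ∀ {E : Type*} [NormedAddCommGroup E]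
    [NormedSpace ℝ E] (N : ℕ) (F : SignVec N × SignVec N → E) (t : ℝ), 0 < t →
    ((Finset.univ.filter fun p => ∃ n, (1 ≤ n ∧ n < 2 ^ N) ∧
        t < ‖∑ q, fejerKernel n p q • F q‖).card : ℝ) * t ≤ C * 4 ^ N * ∑ q, ‖F q‖ := by
  refine ⟨(4 * 180 + 1) * (1 + 2 * 6080), by norm_num, fun N F t ht => ?_⟩
  have := (isDyadicGrid_sameSquare N).weak_type (ι := {n : ℕ // 1 ≤ n ∧ n < 2 ^ N})
    (fun n => Nat.log 2 n) (fun n => Nat.log_lt_of_lt_pow (by have := n.2.1; omega) n.2.2)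
    (fun n => fejerKernel n) fejerMajorant fejerMajorant_nonneg
    (fun n p q => abs_fejerKernel_le (Nat.pow_log_le_self 2 (by have := n.2.1; omega))
      (Nat.lt_pow_succ_log_self (by norm_num) n) p q)
    (fun n p q q' h => fejerKernel_congr (Nat.lt_pow_succ_log_self (by norm_num) n) p h)
    (C₁ := 180) (C₂ := 6080) (by norm_num) (by norm_num)
    (fun n p => sum_abs_fejerKernel_le n.2.1 n.2.2 p)
    (fun k _ q => sum_sum_fejerMajorant_not_sameSquare_le q) F ht
  simpa only [Subtype.exists, exists_prop] using this

/-! ### Reduction of the Fejér means to the grid of dyadic squares -/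

/-- The label of the dyadic interval of length `2 ^ (-N)` which contains `x`. -/
def code (N : ℕ) (x : ℝ) : SignVec N := fun k => (-1) ^ (Real.digits x 2 k : ℕ)

/-- The label of the dyadic square of side `2 ^ (-N)` which contains `x`. -/
def codePair (N : ℕ) (x : ℝ × ℝ) : SignVec N × SignVec N := (code N x.1, code N x.2)

theorem signs_code {N k : ℕ} (h : k < N) (x : ℝ) : signs (code N x) k = rademacher k x := by
  simp [signs, h, code, rademacher]

theorem walsh_eq_paley_signs {N n : ℕ} (h : n < 2 ^ N) (x : ℝ) :
    walsh n x = paley n (signs (code N x)) := by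
  rw [walsh_eq_paley]
  exact paley_congr h fun k hk => (signs_code hk x).symm

theorem measurable_digits (k : ℕ) : Measurable fun x : ℝ => Real.digits x 2 k := by
  unfold Real.digits
  exact (measurable_from_top (f := Fin.ofNat 2)).comp
    (Nat.measurable_floor.comp (measurable_id.mul_const _))

theorem measurableSet_code_preimage (N : ℕ) (v : SignVec N) : MeasurableSet (code N ⁻¹' {v}) := by
  have : code N ⁻¹' {v}
      = ⋂ k : Fin N, (fun x : ℝ => Real.digits x 2 k) ⁻¹' {d | (-1 : ℤˣ) ^ (d : ℕ) = v k} := by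
    ext x
    simp [code, funext_iff]
  rw [this]
  exact MeasurableSet.iInter fun k => measurable_digits k (MeasurableSet.of_discrete)

theorem codePair_preimage (N : ℕ) (q : SignVec N × SignVec N) :
    codePair N ⁻¹' {q} = (code N ⁻¹' {q.1}) ×ˢ (code N ⁻¹' {q.2}) := by
  ext x
  simp [codePair, Prod.ext_iff]

theorem measurableSet_codePair_preimage (N : ℕ) (q : SignVec N × SignVec N) :
    MeasurableSet (codePair N ⁻¹' {q}) := by
  rw [codePair_preimage]
  exact (measurableSet_code_preimage N _).prod (measurableSet_code_preimage N _)

/-- Two points with the same first `N` digits are at distance at most `2^-N`, so the diameter bounds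
the measure; only this upper bound is needed later. -/
theorem volume_code_preimage_inter_le (N : ℕ) (v : SignVec N) :
    volume (code N ⁻¹' {v} ∩ Set.Ico 0 1) ≤ ((2 : ℝ≥0∞) ^ N)⁻¹ := by
  refine (Real.volume_le_diam _).trans (Metric.ediam_le fun x hx y hy => ?_)
  have hd : ∀ k < N, Real.digits x 2 k = Real.digits y 2 k := by
    intro k hk
    have h : code N x = code N y := hx.1.trans hy.1.symm
    have h' := congrFun h ⟨k, hk⟩
    simp only [code] at h'
    generalize Real.digits x 2 k = a at *
    generalize Real.digits y 2 k = b at *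
    revert a b
    decide
  have hs : ∑ i ∈ Finset.range N, Real.ofDigitsTerm (Real.digits x 2) i
      = ∑ i ∈ Finset.range N, Real.ofDigitsTerm (Real.digits y 2) i :=
    Finset.sum_congr rfl fun i hi => by
      simp only [Real.ofDigitsTerm, hd i (Finset.mem_range.1 hi)]
  have x1 := Real.le_sum_ofDigitsTerm_digits (b := 2) hx.2 N
  have x2 := Real.sum_ofDigitsTerm_digits_le (b := 2) hx.2 N
  have y1 := Real.le_sum_ofDigitsTerm_digits (b := 2) hy.2 N
  have y2 := Real.sum_ofDigitsTerm_digits_le (b := 2) hy.2 N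
  have : dist x y ≤ ((2 : ℕ) : ℝ)⁻¹ ^ N := by
    rw [Real.dist_eq, abs_le]
    constructor <;> linarith
  rw [edist_dist]
  refine (ENNReal.ofReal_le_ofReal this).trans (le_of_eq ?_)
  rw [ENNReal.ofReal_pow (by positivity), ENNReal.ofReal_inv_of_pos (by norm_num), ENNReal.inv_pow]
  norm_num

theorem squareMeasure_codePair_preimage_le (N : ℕ) (q : SignVec N × SignVec N) :
    squareMeasure (codePair N ⁻¹' {q}) ≤ ((4 : ℝ≥0∞) ^ N)⁻¹ := by
  rw [squareMeasure, Measure.restrict_apply (measurableSet_codePair_preimage N q),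
    codePair_preimage, unitSquare, Set.prod_inter_prod, Measure.volume_eq_prod, Measure.prod_prod]
  refine (mul_le_mul' (volume_code_preimage_inter_le N _)
    (volume_code_preimage_inter_le N _)).trans (le_of_eq ?_)
  rw [ENNReal.inv_pow, ENNReal.inv_pow, ← mul_pow,
    ← ENNReal.mul_inv (Or.inl (by norm_num)) (Or.inl (by norm_num))]
  norm_num

theorem iUnion_codePair_preimage (N : ℕ) :
    ⋃ q : SignVec N × SignVec N, codePair N ⁻¹' {q} = Set.univ := by
  ext x; simp

theorem pairwise_disjoint_codePair_preimage (N : ℕ) :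
    Pairwise (Function.onFun Disjoint fun q : SignVec N × SignVec N => codePair N ⁻¹' {q}) := by
  intro p q hpq
  exact Disjoint.preimage _ (Set.disjoint_singleton.2 hpq)

instance : IsFiniteMeasure squareMeasure := by
  refine ⟨?_⟩
  rw [squareMeasure, Measure.restrict_apply_univ, unitSquare, Measure.volume_eq_prod,
    Measure.prod_prod]
  simp

variable {𝕜 : Type*} [RCLike 𝕜]

/-- The integral of `f` over the dyadic square with label `q`. -/
def cellMass (N : ℕ) (f : ℝ × ℝ → 𝕜) (q : SignVec N × SignVec N) : 𝕜 :=
  ∫ x in codePair N ⁻¹' {q}, f x ∂squareMeasure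

theorem integral_mul_comp_codePair {N : ℕ} {f : ℝ × ℝ → 𝕜} (hf : Integrable f squareMeasure)
    (h : SignVec N × SignVec N → ℝ) :
    ∫ x, f x * (h (codePair N x) : 𝕜) ∂squareMeasure = ∑ q, h q • cellMass N f q := by
  have cell : ∀ q : SignVec N × SignVec N, Set.EqOn (fun x => f x * (h (codePair N x) : 𝕜))
      (fun x => h q • f x) (codePair N ⁻¹' {q}) := by
    intro q x hx
    have : codePair N x = q := hx
    simp only [this, RCLike.real_smul_eq_coe_mul, mul_comm]
  rw [← setIntegral_univ, ← iUnion_codePair_preimage N,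
    integral_iUnion_fintype (measurableSet_codePair_preimage N)
      (pairwise_disjoint_codePair_preimage N)]
  · refine Finset.sum_congr rfl fun q _ => ?_
    rw [setIntegral_congr_fun (measurableSet_codePair_preimage N q) (cell q), integral_smul]
    rfl
  · intro q
    exact (integrableOn_congr_fun (cell q) (measurableSet_codePair_preimage N q)).2
      (hf.smul (h q)).integrableOn

theorem walshCoeff_eq_sum {N i j : ℕ} (hi : i < 2 ^ N) (hj : j < 2 ^ N) {f : ℝ × ℝ → 𝕜}
    (hf : Integrable f squareMeasure) :
    walshCoeff f i j = ∑ q : SignVec N × SignVec N,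
      (paley i (signs q.1) * paley j (signs q.2)) • cellMass N f q := by
  rw [← integral_mul_comp_codePair hf
    (fun q : SignVec N × SignVec N => paley i (signs q.1) * paley j (signs q.2))]
  unfold walshCoeff
  simp_rw [walsh_eq_paley_signs hi, walsh_eq_paley_signs hj]
  rfl

/-- All Walsh functions that occur have index below `2^N`, hence are constant on the cells, and
multiplicativity of `paley` in the signs turns the mean into a convolution on the group of sign
vectors. -/
theorem triangularFejer_eq_sum {N n : ℕ} (hn : n ≤ 2 ^ N) {f : ℝ × ℝ → 𝕜}
    (hf : Integrable f squareMeasure) (x : ℝ × ℝ) :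
    triangularFejer n f x = ∑ q, fejerKernel n (codePair N x) q • cellMass N f q := by
  have term : ∀ k ∈ Finset.range n, triangularSum k f x
      = ∑ q : SignVec N × SignVec N, (∑ i ∈ Finset.range k, ∑ j ∈ Finset.range (k - i),
          paley i (signs (code N x.1 * q.1)) * paley j (signs (code N x.2 * q.2)))
            • cellMass N f q := by
    intro k hk
    have hk' := Finset.mem_range.1 hk
    simp_rw [Finset.sum_smul]
    rw [Finset.sum_comm]
    refine Finset.sum_congr rfl fun i hi => ?_
    have hi' := Finset.mem_range.1 hi
    rw [Finset.sum_comm]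
    refine Finset.sum_congr rfl fun j hj => ?_
    have hj' := Finset.mem_range.1 hj
    have hiN : i < 2 ^ N := by omega
    have hjN : j < 2 ^ N := by omega
    rw [walshCoeff_eq_sum hiN hjN hf, walsh_eq_paley_signs hiN, walsh_eq_paley_signs hjN,
      Finset.sum_mul]
    refine Finset.sum_congr rfl fun q _ => ?_
    rw [signs_mul, signs_mul, paley_mul, paley_mul, RCLike.real_smul_eq_coe_mul,
      RCLike.real_smul_eq_coe_mul]
    push_cast
    ring
  rw [triangularFejer, Finset.sum_congr rfl term, Finset.sum_comm, Finset.mul_sum]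
  refine Finset.sum_congr rfl fun q _ => ?_
  rw [← Finset.sum_smul, sum_triangle_paley, fejerKernel, RCLike.real_smul_eq_coe_mul,
    RCLike.real_smul_eq_coe_mul, codePair]
  push_cast
  ring

theorem sum_enorm_cellMass_le (N : ℕ) (f : ℝ × ℝ → 𝕜) :
    ∑ q, ‖cellMass N f q‖ₑ ≤ eLpNorm f 1 squareMeasure := by
  rw [eLpNorm_one_eq_lintegral_enorm, ← setLIntegral_univ, ← iUnion_codePair_preimage N,
    lintegral_iUnion (measurableSet_codePair_preimage N) (pairwise_disjoint_codePair_preimage N),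
    tsum_fintype]
  exact Finset.sum_le_sum fun q _ => enorm_integral_le_lintegral_enorm _

theorem norm_cellMass_le {N : ℕ} {f : ℝ × ℝ → 𝕜} {a : ℝ} (ha : 0 ≤ a)
    (hf : ∀ᵐ x ∂squareMeasure, ‖f x‖ ≤ a) (q : SignVec N × SignVec N) :
    ‖cellMass N f q‖ ≤ a / 4 ^ N := by
  refine (norm_setIntegral_le_of_norm_le_const_ae' (C := a) (measure_lt_top _ _) ?_).trans ?_
  · filter_upwards [hf] with x hx _ using hx
  · rw [div_eq_mul_inv]
    refine mul_le_mul_of_nonneg_left ?_ ha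
    have := ENNReal.toReal_mono (by simp) (squareMeasure_codePair_preimage_le N q)
    simpa [Measure.real] using this

theorem norm_triangularFejer_le {f : ℝ × ℝ → 𝕜} (hf : Integrable f squareMeasure) {a : ℝ}
    (ha : 0 ≤ a) (hfa : ∀ᵐ x ∂squareMeasure, ‖f x‖ ≤ a) {n : ℕ} (hn : 1 ≤ n) (x : ℝ × ℝ) :
    ‖triangularFejer n f x‖ ≤ 180 * a := by
  have hn' : n < 2 ^ n := Nat.lt_two_pow_self
  rw [triangularFejer_eq_sum hn'.le hf]
  have h4 : (0 : ℝ) < 4 ^ n := by positivity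
  calc ‖∑ q, fejerKernel n (codePair n x) q • cellMass n f q‖
      ≤ ∑ q, |fejerKernel n (codePair n x) q| * (a / 4 ^ n) := by
        refine norm_sum_le_of_le _ fun q _ => ?_
        rw [norm_smul, Real.norm_eq_abs]
        exact mul_le_mul_of_nonneg_left (norm_cellMass_le ha hfa q) (abs_nonneg _)
    _ ≤ 180 * 4 ^ n * (a / 4 ^ n) := by
        rw [← Finset.sum_mul]
        exact mul_le_mul_of_nonneg_right (sum_abs_fejerKernel_le hn hn' _) (by positivity)
    _ = 180 * a := by field_simp

theorem maximalFejer_le {f : ℝ × ℝ → 𝕜} (hf : Integrable f squareMeasure) {a : ℝ}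
    (ha : 0 ≤ a) (hfa : ∀ᵐ x ∂squareMeasure, ‖f x‖ ≤ a) (x : ℝ × ℝ) :
    maximalFejer f x ≤ ENNReal.ofReal (180 * a) := by
  refine iSup₂_le fun n hn => ?_
  rw [← ofReal_norm]
  exact ENNReal.ofReal_le_ofReal (norm_triangularFejer_le hf ha hfa hn x)

theorem measurable_rademacher (k : ℕ) : Measurable (rademacher k) :=
  (measurable_from_top (f := fun d : Fin 2 => (-1 : ℝ) ^ (d : ℕ))).comp (measurable_digits k)

theorem measurable_walsh (n : ℕ) : Measurable (walsh n) := by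
  unfold walsh
  exact Finset.measurable_prod _ fun k _ => (measurable_rademacher k).pow_const _

theorem measurable_triangularFejer (n : ℕ) (f : ℝ × ℝ → 𝕜) :
    Measurable (triangularFejer n f) := by
  unfold triangularFejer triangularSum
  refine Measurable.const_mul (Finset.measurable_sum _ fun k _ => Finset.measurable_sum _
    fun i _ => Finset.measurable_sum _ fun j _ => Measurable.const_mul ?_ _) _
  exact RCLike.measurable_ofReal.comp
    (((measurable_walsh i).comp measurable_fst).mul ((measurable_walsh j).comp measurable_snd))

theorem measurable_maximalFejer (f : ℝ × ℝ → 𝕜) : Measurable (maximalFejer f) :=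
  Measurable.iSup fun n => Measurable.iSup fun _ => (measurable_triangularFejer n f).enorm

theorem triangularFejer_add {f g : ℝ × ℝ → 𝕜} (hf : Integrable f squareMeasure)
    (hg : Integrable g squareMeasure) (n : ℕ) (x : ℝ × ℝ) :
    triangularFejer n (f + g) x = triangularFejer n f x + triangularFejer n g x := by
  have hn : n ≤ 2 ^ n := Nat.lt_two_pow_self.le
  rw [triangularFejer_eq_sum hn hf, triangularFejer_eq_sum hn hg,
    triangularFejer_eq_sum hn (hf.add hg), ← Finset.sum_add_distrib]
  refine Finset.sum_congr rfl fun q _ => ?_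
  rw [← smul_add]
  congr 1
  exact integral_add hf.integrableOn hg.integrableOn

theorem maximalFejer_add_le {f g : ℝ × ℝ → 𝕜} (hf : Integrable f squareMeasure)
    (hg : Integrable g squareMeasure) (x : ℝ × ℝ) :
    maximalFejer (f + g) x ≤ maximalFejer f x + maximalFejer g x := by
  refine iSup₂_le fun n hn => ?_
  rw [triangularFejer_add hf hg]
  refine (enorm_add_le _ _).trans (add_le_add ?_ ?_)
  · exact le_iSup₂ (f := fun (n : ℕ) (_ : 1 ≤ n) => ‖triangularFejer n f x‖ₑ) n hn
  · exact le_iSup₂ (f := fun (n : ℕ) (_ : 1 ≤ n) => ‖triangularFejer n g x‖ₑ) n hn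

open Classical in
theorem exists_weak_type_bound : ∃ C : ℝ≥0, ∀ {𝕜 : Type*} [RCLike 𝕜] (f : ℝ × ℝ → 𝕜),
    Integrable f squareMeasure → ∀ t : ℝ≥0, 0 < t →
      squareMeasure {x | (t : ℝ≥0∞) < maximalFejer f x}
        ≤ C * eLpNorm f 1 squareMeasure / t := by
  obtain ⟨C, hC, h⟩ := exists_grid_weak_type
  refine ⟨C.toNNReal, fun {𝕜} _ f hf t ht => ?_⟩
  -- The grid of level `N` handles all `n < 2^N`. The grid bound is uniform in `N`, so it passes to
  -- the increasing union.
  let U : ℕ → Set (ℝ × ℝ) := fun N =>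
    {x | ∃ n, (1 ≤ n ∧ n < 2 ^ N) ∧ (t : ℝ) < ‖triangularFejer n f x‖}
  have hU : {x | (t : ℝ≥0∞) < maximalFejer f x} = ⋃ N, U N := by
    ext x
    simp only [maximalFejer, Set.mem_ofPred_eq, lt_iSup_iff, Set.mem_iUnion, U]
    have conv : ∀ n, (t : ℝ≥0∞) < ‖triangularFejer n f x‖ₑ ↔ (t : ℝ) < ‖triangularFejer n f x‖ := by
      intro n
      rw [enorm_eq_nnnorm, ENNReal.coe_lt_coe, ← NNReal.coe_lt_coe, coe_nnnorm]
    constructor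
    · rintro ⟨n, hn, hlt⟩
      exact ⟨n, n, ⟨hn, Nat.lt_two_pow_self⟩, (conv n).1 hlt⟩
    · rintro ⟨N, n, hn, hlt⟩
      exact ⟨n, hn.1, (conv n).2 hlt⟩
  have hmono : Monotone U := fun N M hNM x ⟨n, hn, hlt⟩ =>
    ⟨n, ⟨hn.1, hn.2.trans_le (Nat.pow_le_pow_right (by norm_num) hNM)⟩, hlt⟩
  rw [hU, hmono.measure_iUnion]
  refine iSup_le fun N => ?_
  set S := Finset.univ.filter fun p : SignVec N × SignVec N => ∃ n, (1 ≤ n ∧ n < 2 ^ N) ∧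
        (t : ℝ) < ‖∑ q, fejerKernel n p q • cellMass N f q‖ with hS
  have hUS : U N ⊆ ⋃ q ∈ S, codePair N ⁻¹' {q} := by
    rintro x ⟨n, hn, hlt⟩
    simp only [Set.mem_iUnion, Set.mem_preimage, Set.mem_singleton_iff, exists_prop,
      exists_eq_right', hS, Finset.mem_filter, Finset.mem_univ, true_and]
    exact ⟨n, hn, by rwa [← triangularFejer_eq_sum hn.2.le hf]⟩
  have key := h N (cellMass N f) t (by exact_mod_cast ht)
  rw [← hS] at key
  have hm : squareMeasure (U N) ≤ S.card * ((4 : ℝ≥0∞) ^ N)⁻¹ := by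
    refine (measure_mono hUS).trans ((measure_biUnion_finset_le _ _).trans ?_)
    refine (Finset.sum_le_sum fun q _ => squareMeasure_codePair_preimage_le N q).trans ?_
    rw [Finset.sum_const, nsmul_eq_mul]
  have key' : (S.card : ℝ≥0∞) * t ≤ C.toNNReal * 4 ^ N * eLpNorm f 1 squareMeasure := by
    refine le_trans ?_ (mul_le_mul_right (sum_enorm_cellMass_le N f) _)
    have := ENNReal.ofReal_le_ofReal key
    rw [ENNReal.ofReal_mul (by positivity), ENNReal.ofReal_mul (by positivity),
      ENNReal.ofReal_mul hC, ENNReal.ofReal_sum_of_nonneg fun _ _ => norm_nonneg _,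
      ENNReal.ofReal_pow (by norm_num)] at this
    simpa [enorm_eq_nnnorm, ENNReal.ofReal] using this
  rw [ENNReal.le_div_iff_mul_le (Or.inl (by exact_mod_cast ht.ne')) (Or.inl ENNReal.coe_ne_top)]
  calc squareMeasure (U N) * t ≤ S.card * ((4 : ℝ≥0∞) ^ N)⁻¹ * t := mul_le_mul_left hm _
    _ = ((4 : ℝ≥0∞) ^ N)⁻¹ * (S.card * t) := by ring
    _ ≤ ((4 : ℝ≥0∞) ^ N)⁻¹ * (C.toNNReal * 4 ^ N * eLpNorm f 1 squareMeasure) :=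
        mul_le_mul_right key' _
    _ = (((4 : ℝ≥0∞) ^ N)⁻¹ * 4 ^ N) * (C.toNNReal * eLpNorm f 1 squareMeasure) := by ring
    _ = C.toNNReal * eLpNorm f 1 squareMeasure := by
        rw [ENNReal.inv_mul_cancel (by positivity) (by simp), one_mul]

/-! ### Interpolation -/

/-- The layer-cake formula is used for `T` with exponent `p` and for `φ` with exponent `p - 1`: the
factor `1/t` in the hypothesis lowers the power of `t` by one, and the quotient of the two
prefactors is `p / (p - 1)`. -/
theorem lintegral_rpow_le_of_measure_lt_le {α : Type*} [MeasurableSpace α] {μ ν : Measure α}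
    {T : α → ℝ≥0∞} (hT : AEMeasurable T μ) (hfin : ∀ᵐ x ∂μ, T x ≠ ∞) {φ : α → ℝ}
    (hφ : Measurable φ) (hφ0 : ∀ x, 0 ≤ φ x) {C : ℝ≥0}
    (h : ∀ t : ℝ, 0 < t → μ {x | ENNReal.ofReal t < T x} ≤ C * ν {x | t < φ x} / ENNReal.ofReal t)
    {p : ℝ} (hp : 1 < p) :
    ∫⁻ x, T x ^ p ∂μ
      ≤ ENNReal.ofReal (p / (p - 1)) * C * ∫⁻ x, ENNReal.ofReal (φ x ^ (p - 1)) ∂ν := by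
  have hp1 : 0 < p - 1 := by linarith
  have e : ∫⁻ x, T x ^ p ∂μ = ∫⁻ x, ENNReal.ofReal ((T x).toReal ^ p) ∂μ := by
    refine lintegral_congr_ae ?_
    filter_upwards [hfin] with x hx
    rw [ENNReal.toReal_rpow, ENNReal.ofReal_toReal (ENNReal.rpow_ne_top_of_nonneg (by linarith) hx)]
  have mono : ∫⁻ t in Set.Ioi 0, μ {x | t < (T x).toReal} * ENNReal.ofReal (t ^ (p - 1))
      ≤ C * ∫⁻ t in Set.Ioi 0, ν {x | t < φ x} * ENNReal.ofReal (t ^ (p - 1 - 1)) := by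
    rw [← lintegral_const_mul' _ _ ENNReal.coe_ne_top]
    refine setLIntegral_mono' measurableSet_Ioi fun t ht => ?_
    have ht0 : (0 : ℝ) < t := ht
    have h0 : ENNReal.ofReal t ≠ 0 := by simpa using ht0
    have h1 : μ {x | t < (T x).toReal} ≤ μ {x | ENNReal.ofReal t < T x} := by
      refine measure_mono fun x (hx : t < (T x).toReal) => ?_
      have hx' : T x ≠ ∞ := fun e => by rw [e, ENNReal.toReal_top] at hx; linarith
      exact (ENNReal.ofReal_lt_iff_lt_toReal ht0.le hx').2 hx
    have h2 : ENNReal.ofReal (t ^ (p - 1))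
        = ENNReal.ofReal t * ENNReal.ofReal (t ^ (p - 1 - 1)) := by
      rw [← ENNReal.ofReal_mul ht0.le, ← Real.rpow_one_add' ht0.le (by linarith)]
      congr 2; ring
    calc μ {x | t < (T x).toReal} * ENNReal.ofReal (t ^ (p - 1))
        ≤ C * ν {x | t < φ x} / ENNReal.ofReal t
            * (ENNReal.ofReal t * ENNReal.ofReal (t ^ (p - 1 - 1))) := by
          rw [h2]; exact mul_le_mul_left (h1.trans (h t ht0)) _
      _ = C * (ν {x | t < φ x} * ENNReal.ofReal (t ^ (p - 1 - 1))) := by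
          rw [← mul_assoc, ENNReal.div_mul_cancel h0 ENNReal.ofReal_ne_top, mul_assoc]
  have l1 := lintegral_rpow_eq_lintegral_meas_lt_mul μ
    (f := fun x => (T x).toReal) (Filter.Eventually.of_forall fun x => ENNReal.toReal_nonneg)
    hT.ennreal_toReal (p := p) (by linarith)
  have l2 := lintegral_rpow_eq_lintegral_meas_lt_mul ν (Filter.Eventually.of_forall hφ0)
    hφ.aemeasurable hp1
  rw [e, l1, l2]
  calc _ ≤ ENNReal.ofReal p
        * (C * ∫⁻ t in Set.Ioi 0, ν {x | t < φ x} * ENNReal.ofReal (t ^ (p - 1 - 1))) :=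
        mul_le_mul_right mono _
    _ = _ := by
        have : ENNReal.ofReal p = ENNReal.ofReal (p / (p - 1)) * ENNReal.ofReal (p - 1) := by
          rw [← ENNReal.ofReal_mul (by positivity), div_mul_cancel₀ _ hp1.ne']
        rw [this]; ring

theorem maximalFejer_congr_ae {f g : ℝ × ℝ → 𝕜} (h : f =ᵐ[squareMeasure] g) :
    maximalFejer f = maximalFejer g := by
  have : ∀ i j, walshCoeff f i j = walshCoeff g i j := fun i j =>
    integral_congr_ae (by filter_upwards [h] with x hx; rw [hx])
  funext x
  simp only [maximalFejer, triangularFejer, triangularSum, this]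

/-- The weak type bound at height `n` tends to 0 as `n` grows. -/
theorem ae_maximalFejer_ne_top {f : ℝ × ℝ → 𝕜} (hf : Integrable f squareMeasure) :
    ∀ᵐ x ∂squareMeasure, maximalFejer f x ≠ ∞ := by
  obtain ⟨C, hC⟩ := exists_weak_type_bound
  have hB : C * eLpNorm f 1 squareMeasure ≠ ∞ :=
    ENNReal.mul_ne_top ENNReal.coe_ne_top (memLp_one_iff_integrable.2 hf).2.ne
  rw [ae_iff]
  simp only [not_not]
  have lim : Filter.Tendsto (fun n : ℕ => C * eLpNorm f 1 squareMeasure * (n : ℝ≥0∞)⁻¹)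
      Filter.atTop (nhds 0) := by
    simpa using ENNReal.Tendsto.const_mul ENNReal.tendsto_inv_nat_nhds_zero (Or.inr hB)
  refine le_antisymm (ge_of_tendsto lim ?_) bot_le
  filter_upwards [Filter.eventually_ge_atTop 1] with n hn
  have := hC f hf n (by exact_mod_cast hn)
  rw [div_eq_mul_inv] at this
  refine (measure_mono fun x (hx : maximalFejer f x = ∞) => ?_).trans this
  change _ < maximalFejer f x
  rw [hx]
  exact ENNReal.coe_lt_top

/-- Truncate `f` at height `t / 360`. By the `L^∞` bound with constant 180, the small part has
maximal function at most `t / 2`; the weak type bound at height `t / 2` handles the large part,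
whose `L¹` norm is the `|f|`-weighted measure of the set where `f` is large. -/
theorem exists_measure_maximalFejer_gt_le : ∃ C : ℝ≥0, ∀ {𝕜 : Type*} [RCLike 𝕜] (f : ℝ × ℝ → 𝕜),
    Measurable f → Integrable f squareMeasure → ∀ t : ℝ, 0 < t →
      squareMeasure {x | ENNReal.ofReal t < maximalFejer f x}
        ≤ C * (squareMeasure.withDensity fun x => ‖f x‖ₑ) {x | t < 360 * ‖f x‖}
          / ENNReal.ofReal t := by
  obtain ⟨C, hC⟩ := exists_weak_type_bound
  refine ⟨2 * C, fun {𝕜} _ f hfm hf t ht => ?_⟩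
  set s : Set (ℝ × ℝ) := {x | t < 360 * ‖f x‖} with hs
  have hsm : MeasurableSet s := measurableSet_lt measurable_const (hfm.norm.const_mul 360)
  have hf1 : Integrable (s.indicator f) squareMeasure := hf.indicator hsm
  have hf2 : Integrable (sᶜ.indicator f) squareMeasure := hf.indicator hsm.compl
  have hsmall : ∀ x, maximalFejer (sᶜ.indicator f) x ≤ ENNReal.ofReal (t / 2) := by
    intro x
    refine (maximalFejer_le hf2 (a := t / 360) (by positivity)
      (Filter.Eventually.of_forall fun y => ?_) x).trans (le_of_eq (by congr 1; ring))
    by_cases hy : y ∈ s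
    · rw [Set.indicator_of_notMem (by simpa using hy), norm_zero]; positivity
    · rw [Set.indicator_of_mem (by simpa using hy)]
      have : ¬ t < 360 * ‖f y‖ := hy
      linarith
  have hsub : {x | ENNReal.ofReal t < maximalFejer f x}
      ⊆ {x | ((t / 2).toNNReal : ℝ≥0∞) < maximalFejer (s.indicator f) x} := by
    intro x (hx : ENNReal.ofReal t < maximalFejer f x)
    change ENNReal.ofReal (t / 2) < maximalFejer (s.indicator f) x
    by_contra! hle
    have h1 := maximalFejer_add_le hf1 hf2 x
    rw [Set.indicator_self_add_compl] at h1
    have h2 := h1.trans (add_le_add hle (hsmall x))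
    rw [← ENNReal.ofReal_add (by positivity) (by positivity), add_halves] at h2
    exact absurd hx h2.not_gt
  have hnorm : eLpNorm (s.indicator f) 1 squareMeasure
      = (squareMeasure.withDensity fun x => ‖f x‖ₑ) s := by
    rw [withDensity_apply _ hsm, eLpNorm_one_eq_lintegral_enorm, ← lintegral_indicator hsm]
    refine lintegral_congr fun x => ?_
    rw [enorm_indicator_eq_indicator_enorm]
  refine (measure_mono hsub).trans ((hC _ hf1 _ (by simpa using ht)).trans (le_of_eq ?_))
  change _ / ENNReal.ofReal (t / 2) = _
  rw [hnorm, ENNReal.ofReal_div_of_pos (by norm_num), ENNReal.ofReal_ofNat, div_eq_mul_inv,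
    ENNReal.inv_div (by simp) (by simp), div_eq_mul_inv, div_eq_mul_inv]
  push_cast
  ring

theorem isStrongType_top : IsStrongType ∞
    (maximalFejer : (ℝ × ℝ → 𝕜) → ℝ × ℝ → ℝ≥0∞) := by
  refine ⟨180, fun f hf => ⟨(measurable_maximalFejer f).aemeasurable, ?_⟩⟩
  have hint : Integrable f squareMeasure := hf.integrable le_top
  have ha : ∀ᵐ x ∂squareMeasure, ‖f x‖ ≤ (eLpNorm f ∞ squareMeasure).toReal := by
    filter_upwards [ae_le_eLpNormEssSup (f := f) (μ := squareMeasure)] with x hx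
    rw [← toReal_enorm]
    exact ENNReal.toReal_mono hf.2.ne (by rwa [eLpNorm_exponent_top])
  rw [eLpNorm_exponent_top]
  refine essSup_le_of_ae_le _ (Filter.Eventually.of_forall fun x => ?_)
  refine (maximalFejer_le hint ENNReal.toReal_nonneg ha x).trans (le_of_eq ?_)
  rw [ENNReal.ofReal_mul (by norm_num), ENNReal.ofReal_toReal hf.2.ne]
  simp

theorem isStrongType_of_one_lt {p : ℝ} (hp : 1 < p) : IsStrongType (ENNReal.ofReal p)
    (maximalFejer : (ℝ × ℝ → 𝕜) → ℝ × ℝ → ℝ≥0∞) := by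
  obtain ⟨C, hC⟩ := exists_measure_maximalFejer_gt_le
  have hp0 : 0 < p := by linarith
  -- The power of 360 comes from `φ = 360 ‖g‖` raised to `p - 1`; the density `‖g‖` supplies the
  -- missing power of `‖g‖`.
  set K : ℝ≥0 := (p / (p - 1)).toNNReal * C * ((360 : ℝ≥0) ^ (p - 1)) with hK
  refine ⟨K ^ (1 / p), fun f hf => ⟨(measurable_maximalFejer f).aemeasurable, ?_⟩⟩
  have hle : (1 : ℝ≥0∞) ≤ ENNReal.ofReal p := by simpa using hp.le
  obtain ⟨g, hgm, hfg⟩ : ∃ g : ℝ × ℝ → 𝕜, StronglyMeasurable g ∧ f =ᵐ[squareMeasure] g := hf.1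
  have hg : Integrable g squareMeasure := (hf.integrable hle).congr hfg
  rw [maximalFejer_congr_ae hfg, eLpNorm_congr_ae hfg]
  have main := lintegral_rpow_le_of_measure_lt_le (measurable_maximalFejer g).aemeasurable
    (ae_maximalFejer_ne_top hg) (φ := fun x => 360 * ‖g x‖) (hgm.measurable.norm.const_mul 360)
    (fun x => by positivity) (hC g hgm.measurable hg) hp
  rw [lintegral_withDensity_eq_lintegral_mul _ hgm.measurable.enorm
    ((hgm.measurable.norm.const_mul 360).pow_const (p - 1)).ennreal_ofReal] at main
  have pt : ∀ x, ((fun x => ‖g x‖ₑ) * fun x => ENNReal.ofReal ((360 * ‖g x‖) ^ (p - 1))) x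
      = ((360 : ℝ≥0) ^ (p - 1) : ℝ≥0) * ‖g x‖ₑ ^ p := by
    intro x
    have h1 : ENNReal.ofReal ((360 * ‖g x‖) ^ (p - 1))
        = ((360 : ℝ≥0) ^ (p - 1) : ℝ≥0) * ‖g x‖ₑ ^ (p - 1) := by
      rw [← ENNReal.ofReal_rpow_of_nonneg (by positivity) (by linarith),
        ENNReal.ofReal_mul (by norm_num), ENNReal.mul_rpow_of_nonneg _ _ (by linarith),
        ofReal_norm, ENNReal.coe_rpow_of_nonneg _ (by linarith)]
      norm_num
    have h2 : ‖g x‖ₑ ^ p = ‖g x‖ₑ * ‖g x‖ₑ ^ (p - 1) := by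
      conv_lhs => rw [show p = 1 + (p - 1) by ring,
        ENNReal.rpow_add_of_nonneg _ _ (by norm_num) (by linarith), ENNReal.rpow_one]
    rw [Pi.mul_apply, h1, h2, mul_left_comm]
  simp_rw [pt] at main
  rw [lintegral_const_mul' _ _ ENNReal.coe_ne_top] at main
  have hpo : ENNReal.ofReal p ≠ 0 := by simpa using hp0
  rw [eLpNorm_eq_lintegral_rpow_enorm_toReal hpo ENNReal.ofReal_ne_top,
    eLpNorm_eq_lintegral_rpow_enorm_toReal hpo ENNReal.ofReal_ne_top, ENNReal.toReal_ofReal hp0.le,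
    ENNReal.coe_rpow_of_nonneg _ (by positivity),
    ← ENNReal.mul_rpow_of_nonneg _ _ (by positivity : 0 ≤ 1 / p)]
  refine ENNReal.rpow_le_rpow ?_ (by positivity)
  simp only [enorm_eq_self]
  refine main.trans (le_of_eq ?_)
  rw [hK]
  push_cast
  rw [ENNReal.ofReal]
  ring

end WalshTriangle

end

theorem theorem2 {𝕜 : Type*} [RCLike 𝕜] :
    WalshTriangle.IsWeakTypeOne
      (WalshTriangle.maximalFejer : (ℝ × ℝ → 𝕜) → ℝ × ℝ → ENNReal) ∧
    ∀ p : ENNReal, 1 < p →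
      WalshTriangle.IsStrongType p
        (WalshTriangle.maximalFejer : (ℝ × ℝ → 𝕜) → ℝ × ℝ → ENNReal) := by
  refine ⟨?_, fun p hp => ?_⟩
  · obtain ⟨C, hC⟩ := WalshTriangle.exists_weak_type_bound
    exact ⟨C, fun f hf => ⟨(WalshTriangle.measurable_maximalFejer f).aemeasurable,
      hC f (memLp_one_iff_integrable.1 hf)⟩⟩
  · rcases eq_or_ne p ⊤ with rfl | hp'
    · exact WalshTriangle.isStrongType_top
    · rw [← ENNReal.ofReal_toReal hp']
      refine WalshTriangle.isStrongType_of_one_lt ?_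
      rwa [← ENNReal.toReal_one, ENNReal.toReal_lt_toReal ENNReal.one_ne_top hp']
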